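/- Let $\hat F$ be an oriented marked surface (a surface $F$ with its marked boundary points $M$ removed) with a finite ideal triangulation $\Gamma$ with oriented edges; $\Gamma$ includes all boundary intervals of $\hat F$. Thicken every edge $\gamma\in\Gamma$ to an ideal bigon $\mathcal N(\gamma)$, with sides $\partial_+\mathcal N(\gamma)$ on the left and $\partial_-\mathcal N(\gamma)$ on the right of $\gamma$; for a boundary edge, one of the two sides is the boundary interval itself. The complementary ideal triangles form the set $\mathcal F(\Gamma)$ of faces. A web in $\hat F$ is a crossingless oriented graph, possibly with loop components, whose internal vertices are trivalent sources or sinks and whose univalent vertices are its endpoints on boundary intervals. It is weakly reduced if it has no contractible loops, no internal $2$-gons or $4$-gons, and no path of one or two edges that together with a segment of a boundary interval bounds a disk with interior disjoint from the web. The pyramid $H_d$ of degree $d>0$ in an ideal triangle is the triangular piece of the honeycomb with $d$ endpoints on each side, all pointing outwards: its sources are the triples $s\in\mathbb Z_{\ge 0}^3$ with sum $d-1$, its sinks the triples with sum $d-2$, and from every source $s$ there is one edge towards each side $k\in\{0,1,2\}$ of the triangle, ending at the sink $s-e_k$ if $s_k>0$ and on side $k$ if $s_k=0$. $H_{-d}$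 is $H_d$ with all orientations reversed, and $H_0=\emptyset$. A crossbar web in a bigon consists of disjoint vertical lines connecting its two sides and of crossbars connecting adjacent lines, oriented as a web. It is obtained from a braid diagram with oriented strands, in which no two strands of the same direction cross, by replacing each crossing by a crossbar; it is minimal if this can be done with a diagram in which no two strands cross more than once. A canonical web is a weakly reduced web $W$ whose intersection with every face $T$ is the disjoint union of a pyramid $H_{d_T}$, $d_T\in\mathbb Z$, and of finitely many disjoint oriented arcs connecting different sides of $T$ (corner arcs), and whose intersection with every bigon is a minimal crossbar web. Its coordinates are, for each edge $\gamma$, the numbers $e_{+,\gamma}(W)$ and $e_{-,\gamma}(W)$ of strands crossing $\partial_+\mathcal N(\gamma)$ from left to right and from right to left, and, for each face $T$, the rotation number $r_T(W)$: the number of clockwise corner arcs in $T$ minus the number of counterclockwise ones. They form a vector in $\mathbb Z_{\ge 0}^{\Gamma+\Gamma}\times\mathbb Z^{\mathcal F(\Gamma)}$. For $\varepsilon:\mathcal F(\Gamma)\to\{\pm1\}$, let $\mathcal S_\varepsilon$ be the set of coordinates of all canonical webs $W$ of profile $\varepsilon$, that is, with $\varepsilon(T)\,d_T\ge 0$ for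 every face $T$ (degree $0$ is compatible with both signs). Proposition. For every $\varepsilon$, $\mathcal S_\varepsilon$ is a finitely generated additive submonoid of $\mathbb Z_{\ge 0}^{\Gamma+\Gamma}\times\mathbb Z^{\mathcal F(\Gamma)}$. -/

import Mathlib

/-! Canonical webs in ideally triangulated marked surfaces, and their coordinates. -/

namespace CanonicalWebs

/-- A padded ideal triangulation of an oriented marked surface, as a gluing pattern.
The sides of every ideal triangle are numbered `0, 1, 2` counterclockwise. Every (oriented) edge `γ`
is thickened to an ideal bigon `N(γ)`, whose boundary interval `∂₊N(γ)`, written `(γ, true)`, lies to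
the left of `γ`, and `∂₋N(γ)`, written `(γ, false)`, to its right. `side (T, k)` is the boundary
interval to which side `k` of `T` is attached, so the boundary orientation of `T` agrees with `γ` iff
`side (T, k) = (γ, true)`. A bigon boundary interval to which no triangle is attached is a boundary
interval of the surface (so an edge is internal iff triangles are attached on both of its sides).
Disconnected surfaces, edges with the same triangle on both sides, and arbitrarily many punctures and
marked points are allowed. -/
structure IdealTriangulation (Face Edge : Type*) where
  side : Face × Fin 3 → Edge × Bool
  side_injective : Function.Injective side
  edge_has_side : ∀ γ : Edge, ∃ x : Face × Fin 3, (side x).1 = γ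

/-- Interchange the entries in positions `i` and `i + 1`. -/
def swapAt {α : Type*} : ℕ → List α → List α
  | 0, a :: b :: l => b :: a :: l
  | i + 1, a :: l => a :: swapAt i l
  | _, l => l

/-- An (oriented) crossbar web in an ideal bigon whose sides are oriented from `m₁` to `m₂`.
Its vertical lines run from `∂₊` to `∂₋` and are numbered `0, 1, …` from `m₁` to `m₂`;
`plusSig` is the list of signs at `∂₊`, where `true` stands for `+`: the web runs from `∂₊` to `∂₋`
there. `bars` lists the crossbars in their order from `∂₊` to `∂₋`; the entry `i` is a crossbar
connecting the lines `i` and `i + 1`. Reading each entry `i` as a crossing of the strands in positions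
`i` and `i + 1` gives the braid diagram `β` whose I-resolution `H_β` the crossbar web is. -/
structure CrossbarWeb where
  plusSig : List Bool
  bars : List ℕ

namespace CrossbarWeb

/-- The number of vertical lines. -/
def index (B : CrossbarWeb) : ℕ := B.plusSig.length

/-- The position of crossbar number `l`. -/
def bar (B : CrossbarWeb) (l : ℕ) : ℕ := B.bars.getD l 0

/-- The signs at `∂₋`, again with `true` for a strand running from `∂₊` to `∂₋`. (The orientation of
a vertical line changes at each of its crossbars, as the signs of the strands of `β` get swapped.) -/
def minusSig (B : CrossbarWeb) : List Bool := B.bars.foldl (fun σ i => swapAt i σ) B.plusSig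

/-- Every crossing is between two strands of opposite orientation. -/
def ProperFrom : List Bool → List ℕ → Prop
  | _, [] => True
  | σ, i :: w => (∃ s : Bool, σ[i]? = some s ∧ σ[i + 1]? = some (!s)) ∧ ProperFrom (swapAt i σ) w

/-- The pairs of strands that cross, in order; `π` is the current arrangement of the strands. -/
def crossingPairs : List ℕ → List ℕ → List (Sym2 ℕ)
  | _, [] => []
  | π, i :: w => s(π.getD i 0, π.getD (i + 1) 0) :: crossingPairs (swapAt i π) w

/-- `B = H_β` for a proper braid diagram `β` that is minimal: no two strands cross more than once. -/
def IsMinimal (B : CrossbarWeb) : Prop :=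
  ProperFrom B.plusSig B.bars ∧ (crossingPairs (List.range B.index) B.bars).Nodup

end CrossbarWeb

/-- A canonical web in an ideal triangle: a pyramid `H_d` of degree `d = degree` and corner arcs.
Corner `c` is the ideal vertex between sides `c` and `c + 1`; `arcs c` lists the arcs around it,
starting with the one closest to the vertex, with `true` for an arc oriented clockwise, that is, from
side `c` to side `c + 1`. -/
structure TriangleWeb where
  degree : ℤ
  arcs : Fin 3 → List Bool

namespace TriangleWeb

/-- The endpoints on side `k`, listed counterclockwise, with `true` for outgoing ones: first the arcs
around corner `k - 1 = k + 2`, then the pyramid (all of whose endpoints point outwards if the degree is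
positive, and inwards if it is negative), and then the arcs around corner `k`. -/
def sideWord (t : TriangleWeb) (k : Fin 3) : List Bool :=
  t.arcs (k + 2) ++ List.replicate t.degree.natAbs (decide (0 < t.degree)) ++
    ((t.arcs k).map (fun b => !b)).reverse

/-- The rotation number: clockwise corner arcs minus counterclockwise ones. -/
def rotation (t : TriangleWeb) : ℤ :=
  ∑ c : Fin 3, (((t.arcs c).count true : ℤ) - ((t.arcs c).count false : ℤ))

end TriangleWeb

/-- Cells of the complement of a web, cut along the boundaries of the bigons:
* `bigon γ g l` is a cell of `N(γ)`: the part of the gap between the vertical lines `g - 1` and `g`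
  after the first `l` crossbars and before the next one (levels count from `∂₊` to `∂₋`; the gaps
  `0` and `index` are the outer ones, which contain the ideal vertices `m₁` and `m₂`);
* `strip T c t` is the cell of `T` adjacent to arc number `t` around corner `c`, on the side of the
  ideal vertex;
* `comb T a`, for `a 0 + a 1 + a 2 = |d|`, are the faces of the pyramid `H_d` in the part of `T` not
  cut off by corner arcs; `a k` is the distance from side `k`, in particular the cells with `a k = 0`
  are those that touch side `k`. For `d = 0` there is just one. -/
inductive Cell (Face Edge : Type*)
  | bigon (γ : Edge) (g l : ℕ)
  | strip (T : Face) (c : Fin 3) (t : ℕ)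
  | comb (T : Face) (a : Fin 3 → ℕ)

/-- The internal (trivalent) vertices of a web:
* `bar γ l e` is an end of crossbar number `l` in `N(γ)`, on its left line (`e = false`) or its right
  line (`e = true`);
* `up T s` and `down T s` are the vertices of the honeycomb `H_d`, `n = |d|`. The vertices `up T s`,
  for `s 0 + s 1 + s 2 = n - 1`, are the sources if `d > 0` (the sinks if `d < 0`) and `down T s`,
  for `s 0 + s 1 + s 2 = n - 2`, the other ones. From `up T s` there is one edge in
  the direction of each side `k`: it ends in `down T (s - e_k)` if `s k > 0`, and on side `k` if
  `s k = 0`. -/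
inductive Vertex (Face Edge : Type*)
  | bar (γ : Edge) (l : ℕ) (e : Bool)
  | up (T : Face) (s : Fin 3 → ℕ)
  | down (T : Face) (s : Fin 3 → ℕ)

/-- The segments along which two cells are adjacent: `level γ g l` separates levels `l` and `l + 1` of
gap `g` in `N(γ)`; `wall T k j` is the segment number `j` (counterclockwise, from `0`) into which the
endpoints of the web cut side `k` of `T`. -/
inductive Seam (Face Edge : Type*)
  | level (γ : Edge) (g l : ℕ)
  | wall (T : Face) (k : Fin 3) (j : ℕ)

/-- A (crossingless) web such that its intersection with every face is canonical and its intersection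
with every bigon is a minimal crossbar web; not assumed to be weakly reduced. -/
structure LocalWeb {Face Edge : Type*} (𝒯 : IdealTriangulation Face Edge) where
  face : Face → TriangleWeb
  bigon : Edge → CrossbarWeb
  minimal : ∀ γ, (bigon γ).IsMinimal
  match_plus : ∀ T k γ, 𝒯.side (T, k) = (γ, true) → (bigon γ).plusSig = (face T).sideWord k
  match_minus : ∀ T k γ, 𝒯.side (T, k) = (γ, false) →
    (bigon γ).minusSig = (((face T).sideWord k).map (fun b => !b)).reverse

namespace LocalWeb

variable {Face Edge : Type*} {𝒯 : IdealTriangulation Face Edge}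

/-- The cells that are there. -/
def IsCell (W : LocalWeb 𝒯) : Cell Face Edge → Prop
  | .bigon γ g l => g ≤ (W.bigon γ).index ∧ l ≤ (W.bigon γ).bars.length
  | .strip T c t => t < ((W.face T).arcs c).length
  | .comb T a => a 0 + a 1 + a 2 = (W.face T).degree.natAbs

/-- The vertices that are there. -/
def IsVertex (W : LocalWeb 𝒯) : Vertex Face Edge → Prop
  | .bar γ l _ => l < (W.bigon γ).bars.length
  | .up T s => s 0 + s 1 + s 2 + 1 = (W.face T).degree.natAbs
  | .down T s => s 0 + s 1 + s 2 + 2 = (W.face T).degree.natAbs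

/-- The cells containing the three corners at a vertex. -/
def cornerCell (W : LocalWeb 𝒯) : Vertex Face Edge → Fin 3 → Cell Face Edge
  | .bar γ l e =>
    ![.bigon γ ((W.bigon γ).bar l + 1) l,
      .bigon γ ((W.bigon γ).bar l + 1) (l + 1),
      .bigon γ (if e then (W.bigon γ).bar l + 2 else (W.bigon γ).bar l) l]
  | .up T s => fun k => .comb T (s + Pi.single k 1)
  | .down T s => fun k => .comb T (s + Pi.single (k + 1) 1 + Pi.single (k + 2) 1)

/-- The seams that are there: a gap is interrupted by the crossbars between its two lines. -/
def IsSeam (W : LocalWeb 𝒯) : Seam Face Edge → Prop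
  | .level γ g l => g ≤ (W.bigon γ).index ∧ l < (W.bigon γ).bars.length ∧ (W.bigon γ).bar l + 1 ≠ g
  | .wall T k j => j ≤ ((W.face T).sideWord k).length

/-- The cell of `T` at the segment number `j` of side `k`. -/
def sideCell (W : LocalWeb 𝒯) (T : Face) (k : Fin 3) (j : ℕ) : Cell Face Edge :=
  let m := ((W.face T).arcs (k + 2)).length
  let d := (W.face T).degree.natAbs
  if j < m then .strip T (k + 2) j
  else if j ≤ m + d then .comb T (Pi.single (k + 2) (j - m) + Pi.single (k + 1) (m + d - j))
  else .strip T k (((W.face T).sideWord k).length - j)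

/-- The cell of `N(γ)` at the segment number `g` (from `m₁` to `m₂`) of `∂₊N(γ)` or `∂₋N(γ)`. -/
def bigonSideCell (W : LocalWeb 𝒯) (γ : Edge) (s : Bool) (g : ℕ) : Cell Face Edge :=
  .bigon γ g (if s then 0 else (W.bigon γ).bars.length)

/-- The two cells which meet in a seam. -/
def seamEnds (W : LocalWeb 𝒯) : Seam Face Edge → Cell Face Edge × Cell Face Edge
  | .level γ g l => (.bigon γ g l, .bigon γ g (l + 1))
  | .wall T k j =>
    (W.sideCell T k j,
      W.bigonSideCell (𝒯.side (T, k)).1 (𝒯.side (T, k)).2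
        (if (𝒯.side (T, k)).2 then j else ((W.face T).sideWord k).length - j))

/-- Two cells meeting in a seam. -/
def Adjacent (W : LocalWeb 𝒯) (c c' : Cell Face Edge) : Prop :=
  ∃ s, W.IsSeam s ∧ W.seamEnds s = (c, c')

/-- `R` is (the set of cells of) a connected component of the complement of the web. -/
def IsRegion (W : LocalWeb 𝒯) (R : Set (Cell Face Edge)) : Prop :=
  ∃ c, W.IsCell c ∧ R = {c' | Relation.EqvGen W.Adjacent c c'}

/-- The corners of a region: its boundary runs through that many web vertices. -/
def corners (W : LocalWeb 𝒯) (R : Set (Cell Face Edge)) : Set (Vertex Face Edge × Fin 3) :=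
  {x | W.IsVertex x.1 ∧ W.cornerCell x.1 x.2 ∈ R}

/-- The seams inside a region. -/
def seams (W : LocalWeb 𝒯) (R : Set (Cell Face Edge)) : Set (Seam Face Edge) :=
  {s | W.IsSeam s ∧ (W.seamEnds s).1 ∈ R}

/-- The segments of the boundary of the surface on the boundary of a region. -/
def boundarySegments (W : LocalWeb 𝒯) (R : Set (Cell Face Edge)) : Set (Edge × Bool × ℕ) :=
  {x | (x.1, x.2.1) ∉ Set.range 𝒯.side ∧ x.2.2 ≤ (W.bigon x.1).index ∧
    W.bigonSideCell x.1 x.2.1 x.2.2 ∈ R}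

/-- The region runs into a puncture or a marked point. -/
def HasIdealPoint (W : LocalWeb 𝒯) (R : Set (Cell Face Edge)) : Prop :=
  ∃ γ g l, Cell.bigon γ g l ∈ R ∧ (g = 0 ∨ g = (W.bigon γ).index)

/-- `R` is a region of the complement of the web which is a disk, away from the punctures and marked
points, with `m` segments of the boundary of the surface and `n` web vertices on its boundary. Since a
region is glued from contractible cells along contractible seams, it is a disk iff its Euler
characteristic, the number of its cells minus the number of its seams, is `1`.
For `m = 0` this is an internal `n`-gon (and a disk bounded by a loop component for `n = 0`). For
`m = 1` it is a disk cut off by a path of `n + 1` edges parallel to a boundary interval. -/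
def IsPolygon (W : LocalWeb 𝒯) (R : Set (Cell Face Edge)) (m n : ℕ) : Prop :=
  W.IsRegion R ∧ ¬ W.HasIdealPoint R ∧ R.ncard = (W.seams R).ncard + 1 ∧
    (W.boundarySegments R).ncard = m ∧ (W.corners R).ncard = n

/-- No contractible loops, no internal 2-gons and no internal 4-gons. (If there are contractible loops
but no 2-gons and 4-gons, then there is a contractible loop bounding a disk disjoint from
the rest of the web, so it is enough to exclude these.) -/
def NonElliptic (W : LocalWeb 𝒯) : Prop :=
  ∀ R, ¬ W.IsPolygon R 0 0 ∧ ¬ W.IsPolygon R 0 2 ∧ ¬ W.IsPolygon R 0 4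

/-- Non-elliptic and without paths of one or two edges parallel to a boundary interval. -/
def WeaklyReduced (W : LocalWeb 𝒯) : Prop :=
  W.NonElliptic ∧ ∀ R, ¬ W.IsPolygon R 1 0 ∧ ¬ W.IsPolygon R 1 1

/-- The coordinates: `e₊` and `e₋` for every edge, and the rotation number for every face. -/
def coordinates (W : LocalWeb 𝒯) : (Edge → ℕ) × (Edge → ℕ) × (Face → ℤ) :=
  (fun γ => (W.bigon γ).plusSig.count true, fun γ => (W.bigon γ).plusSig.count false,
    fun T => (W.face T).rotation)

/-- `W` has profile `ε`: no degree has sign opposite to `ε`. (Degree `0` is allowed for both signs.) -/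
def HasProfile (W : LocalWeb 𝒯) (ε : Face → ℤˣ) : Prop :=
  ∀ T, 0 ≤ (ε T : ℤ) * (W.face T).degree

end LocalWeb

/-- A canonical web: a weakly reduced web in canonical position. -/
structure CanonicalWeb {Face Edge : Type*} (𝒯 : IdealTriangulation Face Edge) extends
    LocalWeb 𝒯 where
  weaklyReduced : toLocalWeb.WeaklyReduced

/-- The set `S_ε` of the coordinates of all canonical webs of profile `ε`. -/
def coordinateSet {Face Edge : Type*} (𝒯 : IdealTriangulation Face Edge) (ε : Face → ℤˣ) :
    Set ((Edge → ℕ) × (Edge → ℕ) × (Face → ℤ)) :=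
  {x | ∃ W : CanonicalWeb 𝒯, W.toLocalWeb.HasProfile ε ∧ W.toLocalWeb.coordinates = x}

end CanonicalWebs

/-! A web of fixed profile is recorded by natural numbers: in each face the absolute value of the
degree and, at each corner, the numbers of arcs of both directions. Since the profile fixes the sign
of every pyramid, the number of endpoints of each sign on a side is an additive function of these
counts. Matching along edges is therefore a system of linear equations over the natural numbers,
whose solutions form a finitely generated monoid (`fg_matching`). The coordinates are additive in
the counts as well (`coordinates_eq`), so the coordinate set is the image of this monoid, provided
that every solution comes from a weakly reduced web.

To realize a solution, order the corner arcs arbitrarily. The sign words on the two sides of an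
internal bigon are then permutations of each other, and some minimal braid diagram connects them
(`exists_isMinimal`). The resulting local web need not be weakly reduced.

A combinatorial Gauss-Bonnet count controls the failure. Give a cell one token for each web corner
in it and two for each boundary segment and each end of a seam. Every cell has at least four tokens,
so for a disk with `m` boundary segments and `n` corners the Euler characteristic expresses `n + 2 *
m - 4` as the sum of the nonnegative excesses over four (`IsPolygon.four_le`). The only forbidden
disk that survives is the internal 4-gon, and then no cell has an excess: the disk is a ladder,
running between antiparallel lines and ending at crossbars.

A ladder is eliminated by exchanging the lines on its two sides and deleting the crossbars at its
ends (`reduce`). All counts persist, and minimality persists because the crossings of the new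
diagrams are among the old ones (`crossingPairs_prune`). The number of crossbars drops, so the
process ends at a weakly reduced web with the prescribed counts (`exists_weaklyReduced`). -/

namespace CanonicalWebs

/-! ### Exchanging neighbouring entries of words. -/

section Lists

variable {α β : Type*}

@[simp] theorem length_swapAt (i : ℕ) (σ : List α) : (swapAt i σ).length = σ.length := by
  induction i generalizing σ with
  | zero => rcases σ with _ | ⟨a, _ | ⟨b, l⟩⟩ <;> simp [swapAt]
  | succ i ih => rcases σ with _ | ⟨a, l⟩ <;> simp [swapAt, ih]

theorem swapAt_perm (i : ℕ) (σ : List α) : (swapAt i σ).Perm σ := by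
  induction i generalizing σ with
  | zero =>
    rcases σ with _ | ⟨a, _ | ⟨b, l⟩⟩ <;> simp only [swapAt, List.Perm.refl]
    exact List.Perm.swap a b l
  | succ i ih =>
    rcases σ with _ | ⟨a, l⟩ <;> simp only [swapAt, List.Perm.refl]
    exact (ih l).cons a

theorem map_swapAt (f : α → β) (i : ℕ) (σ : List α) :
    (swapAt i σ).map f = swapAt i (σ.map f) := by
  induction i generalizing σ with
  | zero => rcases σ with _ | ⟨a, _ | ⟨b, l⟩⟩ <;> simp [swapAt]
  | succ i ih => rcases σ with _ | ⟨a, l⟩ <;> simp [swapAt, ih]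

theorem getElem?_swapAt {i : ℕ} {σ : List α} (h : i + 1 < σ.length) (j : ℕ) :
    (swapAt i σ)[j]? = σ[if j = i then i + 1 else if j = i + 1 then i else j]? := by
  induction i generalizing σ j with
  | zero =>
    rcases σ with _ | ⟨a, _ | ⟨b, l⟩⟩
    · simp at h
    · simp at h
    · rcases j with _ | _ | j <;> simp [swapAt]
  | succ i ih =>
    rcases σ with _ | ⟨a, l⟩
    · simp at h
    · simp only [List.length_cons, Nat.add_lt_add_iff_right] at h
      rcases j with _ | j
      · simp [swapAt]
      · simp only [swapAt, List.getElem?_cons_succ, ih h, Nat.add_right_cancel_iff]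
        split_ifs <;> simp

@[simp] theorem length_foldl_swapAt (w : List ℕ) (σ : List α) :
    (w.foldl (fun σ i => swapAt i σ) σ).length = σ.length := by
  induction w generalizing σ with
  | nil => rfl
  | cons i w ih => simp [ih]

theorem foldl_swapAt_perm (w : List ℕ) (σ : List α) :
    (w.foldl (fun σ i => swapAt i σ) σ).Perm σ := by
  induction w generalizing σ with
  | nil => rfl
  | cons i w ih => exact (ih _).trans (swapAt_perm i σ)

/-- A set of inner gaps in a row of `n` lines, no two of which share a line. -/
structure IsGapSet (P : ℕ → Prop) (n : ℕ) : Prop where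
  not_zero : ¬ P 0
  lt : ∀ g, P g → g < n
  isolated : ∀ g, P g → ¬ P (g + 1)

open Classical in
/-- The involution interchanging the positions `g - 1` and `g` for all gaps `g` in `P`. -/
noncomputable def twistIndex (P : ℕ → Prop) (j : ℕ) : ℕ :=
  if P (j + 1) then j + 1 else if P j then j - 1 else j

theorem twistIndex_of_left {P : ℕ → Prop} {j : ℕ} (h : P (j + 1)) : twistIndex P j = j + 1 :=
  if_pos h

theorem twistIndex_of_right {P : ℕ → Prop} {j : ℕ} (h : P (j + 1)) (h' : ¬ P (j + 2)) :
    twistIndex P (j + 1) = j := by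
  simp [twistIndex, h, h']

theorem twistIndex_of_not {P : ℕ → Prop} {j : ℕ} (h : ¬ P j) (h' : ¬ P (j + 1)) :
    twistIndex P j = j := by
  simp [twistIndex, h, h']

open Classical in
theorem twistIndex_congr {P Q : ℕ → Prop} {j : ℕ} (h : P j ↔ Q j) (h' : P (j + 1) ↔ Q (j + 1)) :
    twistIndex P j = twistIndex Q j := by
  unfold twistIndex
  exact if_congr h' rfl (if_congr h rfl rfl)

/-- Interchange the entries in the positions `g - 1` and `g` for all gaps `g` in `P`. -/
noncomputable def twist (P : ℕ → Prop) (σ : List α) : List α :=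
  -- For a gap set of `σ` the twisted index stays in range, so the default `a` is never used.
  σ.mapIdx fun j a => σ.getD (twistIndex P j) a

@[simp] theorem length_twist (P : ℕ → Prop) (σ : List α) : (twist P σ).length = σ.length := by
  simp [twist]

theorem IsGapSet.twistIndex_lt {P : ℕ → Prop} {n j : ℕ} (hP : IsGapSet P n) (hj : j < n) :
    twistIndex P j < n := by
  unfold twistIndex
  split_ifs with h
  · exact hP.lt _ h
  · omega
  · exact hj

theorem IsGapSet.twistIndex_of_le {P : ℕ → Prop} {n j : ℕ} (hP : IsGapSet P n) (hj : n ≤ j) :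
    twistIndex P j = j := by
  have h₁ : ¬ P (j + 1) := fun h => by have := hP.lt _ h; omega
  have h₂ : ¬ P j := fun h => by have := hP.lt _ h; omega
  simp [twistIndex, h₁, h₂]

theorem IsGapSet.twistIndex_twistIndex {P : ℕ → Prop} {n : ℕ} (hP : IsGapSet P n) (j : ℕ) :
    twistIndex P (twistIndex P j) = j := by
  by_cases h₁ : P (j + 1)
  · rw [twistIndex_of_left h₁, twistIndex_of_right h₁ (hP.isolated _ h₁)]
  by_cases h₂ : P j
  · obtain ⟨j, rfl⟩ : ∃ i, j = i + 1 := Nat.exists_eq_succ_of_ne_zero <| by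
      rintro rfl
      exact hP.not_zero h₂
    rw [twistIndex_of_right h₂ h₁, twistIndex_of_left h₂]
  · rw [twistIndex_of_not h₂ h₁, twistIndex_of_not h₂ h₁]

theorem getElem?_twist {P : ℕ → Prop} {σ : List α} (hP : IsGapSet P σ.length) (j : ℕ) :
    (twist P σ)[j]? = σ[twistIndex P j]? := by
  by_cases hj : j < σ.length
  · have := hP.twistIndex_lt hj
    simp [twist, hj, this]
  · push Not at hj
    rw [hP.twistIndex_of_le hj, List.getElem?_eq_none (by simpa using hj),
      List.getElem?_eq_none hj]

theorem twist_perm {P : ℕ → Prop} {σ : List α} (hP : IsGapSet P σ.length) :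
    (twist P σ).Perm σ := by
  let f : Fin σ.length → Fin σ.length := fun j => ⟨twistIndex P j, hP.twistIndex_lt j.2⟩
  have hf : Function.Involutive f := fun j => Fin.ext (hP.twistIndex_twistIndex j)
  have h := Equiv.Perm.ofFn_comp_perm hf.toPerm σ.get
  rw [List.ofFn_get] at h
  refine (List.Perm.of_eq (List.ext_getElem? fun j => ?_)).trans h
  rw [getElem?_twist hP]
  by_cases hj : j < σ.length
  · have := hP.twistIndex_lt hj
    simp [hj, this, f]
  · simp [hj, hP.twistIndex_of_le (not_lt.1 hj)]

theorem twist_of_forall_not {P : ℕ → Prop} (hP : ∀ g, ¬ P g) (σ : List α) : twist P σ = σ := by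
  refine List.ext_getElem? fun j => ?_
  rw [getElem?_twist ⟨hP 0, fun g h => (hP g h).elim, fun g _ => hP _⟩]
  simp [twistIndex, hP]

theorem twist_map (f : α → β) {P : ℕ → Prop} {σ : List α} (hP : IsGapSet P σ.length) :
    twist P (σ.map f) = (twist P σ).map f := by
  refine List.ext_getElem? fun j => ?_
  rw [getElem?_twist (by simpa using hP), List.getElem?_map, List.getElem?_map, getElem?_twist hP]

/-- No exchange takes place across the junction of the two words, so both parts can be twisted
separately. This is how the exchange on a side of a triangle splits into exchanges of corner arcs.
-/
theorem twist_append {P Q R : ℕ → Prop} {A B : List α} (hP : IsGapSet P (A ++ B).length)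
    (hQ : IsGapSet Q A.length) (hR : IsGapSet R B.length) (h₁ : ∀ j < A.length, (P j ↔ Q j))
    (h₂ : ¬ P A.length) (h₃ : ∀ j, 0 < j → (P (A.length + j) ↔ R j)) :
    twist P (A ++ B) = twist Q A ++ twist R B := by
  refine List.ext_getElem? fun j => ?_
  rw [getElem?_twist hP, List.getElem?_append, List.getElem?_append, length_twist,
    getElem?_twist hQ, getElem?_twist hR]
  by_cases hj : j < A.length
  · have e : twistIndex P j = twistIndex Q j := by
      refine twistIndex_congr (h₁ _ hj) ?_
      by_cases hj' : j + 1 < A.length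
      · exact h₁ _ hj'
      · have : j + 1 = A.length := by omega
        have hq : ¬ Q (j + 1) := fun h => by have := hQ.lt _ h; omega
        exact iff_of_false (this ▸ h₂) hq
    rw [e, if_pos (hQ.twistIndex_lt hj), if_pos hj]
  · obtain ⟨i, rfl⟩ := Nat.exists_eq_add_of_le (not_lt.1 hj)
    have e : twistIndex P (A.length + i) = A.length + twistIndex R i := by
      have h4 := h₃ (i + 1) (by omega)
      by_cases hr : R (i + 1)
      · rw [twistIndex_of_left hr, ← add_assoc]
        exact twistIndex_of_left (h4.2 hr)
      rcases i with _ | i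
      · rw [twistIndex_of_not hR.not_zero hr]
        exact twistIndex_of_not h₂ (mt h4.1 hr)
      · have h5 := h₃ (i + 1) (by omega)
        by_cases hr' : R (i + 1)
        · rw [twistIndex_of_right hr' hr]
          exact twistIndex_of_right (h5.2 hr') (mt h4.1 hr)
        · rw [twistIndex_of_not hr' hr]
          exact twistIndex_of_not (mt h5.1 hr') (mt h4.1 hr)
    rw [e, if_neg (by omega), if_neg hj]
    simp

theorem twist_reverse {P Q : ℕ → Prop} {A : List α} (hP : IsGapSet P A.length)
    (hQ : IsGapSet Q A.length) (h : ∀ j ≤ A.length, (P j ↔ Q (A.length - j))) :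
    twist P A.reverse = (twist Q A).reverse := by
  refine List.ext_getElem? fun j => ?_
  rw [getElem?_twist (by simpa using hP)]
  by_cases hj : j < A.length
  · have h1 := hP.twistIndex_lt hj
    rw [List.getElem?_reverse h1, List.getElem?_reverse (by simpa using hj), length_twist,
      getElem?_twist hQ]
    congr 1
    unfold twistIndex
    rw [h _ hj.le, h (j + 1) hj, show A.length - 1 - j + 1 = A.length - j by omega,
      show A.length - 1 - j = A.length - (j + 1) by omega]
    have := hQ.isolated (A.length - (j + 1))
    rw [show A.length - (j + 1) + 1 = A.length - j by omega] at this
    have h0 := hP.not_zero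
    rw [h 0 (by omega)] at h0
    by_cases a : Q (A.length - (j + 1)) <;> by_cases b : Q (A.length - j)
    · exact (this a b).elim
    · simp only [a, b, if_true, if_false]
      omega
    · rcases j with _ | j
      · exact (h0 b).elim
      · simp only [a, b, if_true, if_false]
        omega
    · simp only [a, b, if_false]
      omega
  · rw [hP.twistIndex_of_le (not_lt.1 hj)]
    simp [hj]

/-- The lines `i` and `i + 1` border only the gaps `i`, `i + 1` and `i + 2`; if none of these is
twisted, the two operations move disjoint sets of lines. -/
theorem swapAt_twist {P : ℕ → Prop} {i : ℕ} {σ : List α} (hP : IsGapSet P σ.length)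
    (hi : i + 1 < σ.length) (h₀ : ¬ P i) (h₁ : ¬ P (i + 1)) (h₂ : ¬ P (i + 2)) :
    swapAt i (twist P σ) = twist P (swapAt i σ) := by
  refine List.ext_getElem? fun j => ?_
  rw [getElem?_swapAt (by simpa using hi), getElem?_twist hP, getElem?_twist (by simpa using hP),
    getElem?_swapAt hi]
  congr 1
  unfold twistIndex
  have := hP.not_zero
  grind

/-- If exactly one of the two gap sets contains the gap of the crossing, then the crossing is itself
the difference of the two exchanges. Deleting it thus makes up for the start or the end of a ladder.
-/
theorem twist_swapAt_of_ne {P Q : ℕ → Prop} {i : ℕ} {σ : List α} (hP : IsGapSet P σ.length)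
    (hQ : IsGapSet Q σ.length) (hi : i + 1 < σ.length) (h : ∀ g, g ≠ i + 1 → (P g ↔ Q g))
    (h₁ : ¬ (P (i + 1) ↔ Q (i + 1))) (h₀ : ¬ P i) (h₂ : ¬ P (i + 2)) :
    twist Q (swapAt i σ) = twist P σ := by
  refine List.ext_getElem? fun j => ?_
  rw [getElem?_twist (by simpa using hQ), getElem?_twist hP, getElem?_swapAt hi]
  congr 1
  have hQ₀ : ¬ Q i := by rwa [← h i (by omega)]
  have hQ₂ : ¬ Q (i + 2) := by rwa [← h (i + 2) (by omega)]
  by_cases e₁ : j = i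
  · subst e₁
    by_cases hp : P (j + 1)
    · have hq : ¬ Q (j + 1) := by tauto
      rw [twistIndex_of_left hp, twistIndex_of_not hQ₀ hq, if_pos rfl]
    · have hq : Q (j + 1) := by tauto
      rw [twistIndex_of_not h₀ hp, twistIndex_of_left hq, if_neg (by omega), if_pos rfl]
  by_cases e₂ : j = i + 1
  · subst e₂
    by_cases hp : P (i + 1)
    · have hq : ¬ Q (i + 1) := by tauto
      rw [twistIndex_of_right hp h₂, twistIndex_of_not hq hQ₂, if_neg (by omega), if_pos rfl]
    · have hq : Q (i + 1) := by tauto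
      rw [twistIndex_of_not hp h₂, twistIndex_of_right hq hQ₂, if_pos rfl]
  rw [twistIndex_congr (h j e₂) (h (j + 1) (by omega))]
  have e₃ : twistIndex Q j ≠ i := fun e => by
    have := hQ.not_zero
    unfold twistIndex at e
    split_ifs at e with a b
    · exact hQ₀ (e ▸ a)
    · rcases j with _ | j
      · exact this b
      · omega
    · exact e₁ e
  have e₄ : twistIndex Q j ≠ i + 1 := fun e => by
    unfold twistIndex at e
    split_ifs at e with a b
    · omega
    · obtain rfl : j = i + 2 := by omega
      exact hQ₂ b
    · exact e₂ e
  rw [if_neg e₃, if_neg e₄]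

/-! ### Deleting the crossings at the ends of ladders. -/

/-- The gap sets `P` and `Q` above and below a crossing in position `i` are compatible. -/
structure GapStep (P Q : ℕ → Prop) (i : ℕ) : Prop where
  iff_of_ne : ∀ g, g ≠ i + 1 → (P g ↔ Q g)
  not_left : ¬ P i
  not_right : ¬ P (i + 2)
  not_both : ¬ (P (i + 1) ∧ Q (i + 1))

open Classical in
/-- Delete the crossings in the gaps of `P`, where `P l` are the gaps at level `l`. -/
noncomputable def prune : (ℕ → ℕ → Prop) → List ℕ → List ℕ
  | _, [] => []
  | P, i :: w =>
    if P 0 (i + 1) ∨ P 1 (i + 1) then prune (fun l => P (l + 1)) w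
    else i :: prune (fun l => P (l + 1)) w

open Classical in
theorem prune_cons (P : ℕ → ℕ → Prop) (i : ℕ) (w : List ℕ) :
    prune P (i :: w) = if P 0 (i + 1) ∨ P 1 (i + 1) then prune (fun l => P (l + 1)) w
      else i :: prune (fun l => P (l + 1)) w := rfl

theorem length_prune_le (P : ℕ → ℕ → Prop) (w : List ℕ) : (prune P w).length ≤ w.length := by
  induction w generalizing P with
  | nil => simp [prune]
  | cons i w ih =>
    rw [prune_cons]
    have := ih fun l => P (l + 1)
    split_ifs <;> simp only [List.length_cons] <;> omega

theorem length_prune_lt {P : ℕ → ℕ → Prop} {w : List ℕ} {l : ℕ} (hl : l < w.length)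
    (h : P l (w.getD l 0 + 1) ∨ P (l + 1) (w.getD l 0 + 1)) :
    (prune P w).length < w.length := by
  induction w generalizing P l with
  | nil => simp at hl
  | cons i w ih =>
    rw [prune_cons]
    rcases l with _ | l
    · have := length_prune_le (fun l => P (l + 1)) w
      simp only [List.getD_cons_zero, zero_add] at h
      simp only [h, if_true, List.length_cons]
      omega
    · have := ih (P := fun l => P (l + 1)) (l := l) (by simpa using hl) (by simpa using h)
      split_ifs <;> simp only [List.length_cons] <;> omega

open CrossbarWeb

theorem add_one_lt_of_proper {σ : List Bool} {i : ℕ}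
    (h : ∃ s : Bool, σ[i]? = some s ∧ σ[i + 1]? = some (!s)) : i + 1 < σ.length := by
  obtain ⟨s, -, h⟩ := h
  exact (List.getElem?_eq_some_iff.1 h).1

/-- The state of a sequence of crossings after the first `l` of them. -/
def stateAt (w : List ℕ) (l : ℕ) (σ : List α) : List α :=
  (w.take l).foldl (fun σ i => swapAt i σ) σ

@[simp] theorem length_stateAt (w : List ℕ) (l : ℕ) (σ : List α) :
    (stateAt w l σ).length = σ.length := by
  simp [stateAt]

theorem stateAt_succ {w : List ℕ} {l : ℕ} (h : l < w.length) (σ : List α) :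
    stateAt w (l + 1) σ = swapAt (w.getD l 0) (stateAt w l σ) := by
  rw [stateAt, List.take_add_one, List.foldl_append]
  simp [stateAt, h]

theorem CrossbarWeb.ProperFrom.stateAt {σ : List Bool} {w : List ℕ} (hw : ProperFrom σ w) {l : ℕ}
    (hl : l < w.length) : ∃ s : Bool, (stateAt w l σ)[w.getD l 0]? = some s ∧
      (CanonicalWebs.stateAt w l σ)[w.getD l 0 + 1]? = some (!s) := by
  induction w generalizing σ l with
  | nil => simp at hl
  | cons i w ih =>
    rcases l with _ | l
    · exact hw.1
    · exact ih hw.2 (by simpa using hl)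

/-- Level by level, the pruned diagram is in the twisted state of the original one: a deleted
crossing is absorbed by the change of the gap set, and a surviving one commutes with the twist. -/
theorem foldl_prune {P : ℕ → ℕ → Prop} {w : List ℕ} {σ : List α}
    (hP : ∀ l ≤ w.length, IsGapSet (P l) σ.length)
    (hs : ∀ l < w.length, GapStep (P l) (P (l + 1)) (w.getD l 0))
    (hw : ∀ i ∈ w, i + 1 < σ.length) :
    (prune P w).foldl (fun σ i => swapAt i σ) (twist (P 0) σ) =
      twist (P w.length) (w.foldl (fun σ i => swapAt i σ) σ) := by
  induction w generalizing P σ with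
  | nil => rfl
  | cons i w ih =>
    have hi := hw i (by simp)
    have ih := @ih (fun l => P (l + 1)) (swapAt i σ)
      (fun l hl => by simpa using hP (l + 1) (by simpa using hl))
      (fun l hl => by simpa using hs (l + 1) (by simpa using hl))
      (fun j hj => by simpa using hw j (by simp [hj]))
    have h0 : GapStep (P 0) (P 1) i := hs 0 (by simp)
    have hP0 := hP 0 (by simp)
    have hP1 := hP 1 (by simp)
    simp only [List.foldl_cons, List.length_cons]
    rw [← ih]
    rw [prune_cons]
    split_ifs with h
    · rw [zero_add, twist_swapAt_of_ne hP0 hP1 hi h0.iff_of_ne (by have := h0.not_both; tauto)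
        h0.not_left h0.not_right]
    · push Not at h
      -- The gap of a surviving crossing lies in neither set, so the sets above and below coincide.
      have e : P 0 = P 1 := funext fun g => propext <| by
        by_cases hg : g = i + 1
        · subst hg
          simp [h]
        · exact h0.iff_of_ne g hg
      rw [List.foldl_cons, swapAt_twist hP0 hi h0.not_left h.1 h0.not_right, zero_add, e]

theorem ProperFrom.prune {P : ℕ → ℕ → Prop} {w : List ℕ} {σ : List Bool}
    (hP : ∀ l ≤ w.length, IsGapSet (P l) σ.length)
    (hs : ∀ l < w.length, GapStep (P l) (P (l + 1)) (w.getD l 0)) (hw : ProperFrom σ w) :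
    ProperFrom (twist (P 0) σ) (prune P w) := by
  induction w generalizing P σ with
  | nil => trivial
  | cons i w ih =>
    have hi := add_one_lt_of_proper hw.1
    have ih := @ih (fun l => P (l + 1)) (swapAt i σ)
      (fun l hl => by simpa using hP (l + 1) (by simpa using hl))
      (fun l hl => by simpa using hs (l + 1) (by simpa using hl)) hw.2
    have h0 : GapStep (P 0) (P 1) i := hs 0 (by simp)
    have hP0 := hP 0 (by simp)
    have hP1 := hP 1 (by simp)
    rw [prune_cons]
    split_ifs with h
    · rwa [zero_add, twist_swapAt_of_ne hP0 hP1 hi h0.iff_of_ne (by have := h0.not_both; tauto)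
        h0.not_left h0.not_right] at ih
    · push Not at h
      have e : P 0 = P 1 := funext fun g => propext <| by
        by_cases hg : g = i + 1
        · subst hg
          simp [h]
        · exact h0.iff_of_ne g hg
      refine ⟨?_, ?_⟩
      · have e0 : twistIndex (P 0) i = i := by simp [twistIndex, h.1, h0.not_left]
        have e1 : twistIndex (P 0) (i + 1) = i + 1 := by simp [twistIndex, h.1, h0.not_right]
        rw [getElem?_twist hP0, getElem?_twist hP0, e0, e1]
        exact hw.1
      · rw [swapAt_twist hP0 hi h0.not_left h.1 h0.not_right, e]
        exact ih

/-- With the strands relabelled by the initial twist, each surviving crossing is between the same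
two strands as before. Pruning can thus only remove pairs and creates no double crossing. -/
theorem crossingPairs_prune {P : ℕ → ℕ → Prop} {w π : List ℕ}
    (hP : ∀ l ≤ w.length, IsGapSet (P l) π.length)
    (hs : ∀ l < w.length, GapStep (P l) (P (l + 1)) (w.getD l 0))
    (hw : ∀ i ∈ w, i + 1 < π.length) :
    (crossingPairs (twist (P 0) π) (prune P w)).Sublist (crossingPairs π w) := by
  induction w generalizing P π with
  | nil => exact List.Sublist.refl _
  | cons i w ih =>
    have hi := hw i (by simp)
    have ih := @ih (fun l => P (l + 1)) (swapAt i π)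
      (fun l hl => by simpa using hP (l + 1) (by simpa using hl))
      (fun l hl => by simpa using hs (l + 1) (by simpa using hl))
      (fun j hj => by simpa using hw j (by simp [hj]))
    have h0 : GapStep (P 0) (P 1) i := hs 0 (by simp)
    have hP0 := hP 0 (by simp)
    have hP1 := hP 1 (by simp)
    rw [prune_cons]
    split_ifs with h
    · rw [zero_add, twist_swapAt_of_ne hP0 hP1 hi h0.iff_of_ne (by have := h0.not_both; tauto)
        h0.not_left h0.not_right] at ih
      exact ih.cons _
    · push Not at h
      have e : P 0 = P 1 := funext fun g => propext <| by
        by_cases hg : g = i + 1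
        · subst hg
          simp [h]
        · exact h0.iff_of_ne g hg
      have e0 : twistIndex (P 0) i = i := by simp [twistIndex, h.1, h0.not_left]
      have e1 : twistIndex (P 0) (i + 1) = i + 1 := by simp [twistIndex, h.1, h0.not_right]
      simp only [crossingPairs, List.getD_eq_getElem?_getD, getElem?_twist hP0, e0, e1]
      rw [swapAt_twist hP0 hi h0.not_left h.1 h0.not_right, e]
      exact ih.cons_cons _

theorem crossingPairs_map (f : ℕ → ℕ) {w π : List ℕ} (hw : ∀ i ∈ w, i + 1 < π.length) :
    crossingPairs (π.map f) w = (crossingPairs π w).map (Sym2.map f) := by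
  induction w generalizing π with
  | nil => rfl
  | cons i w ih =>
    have hi := hw i (by simp)
    have hi' : i < π.length := by omega
    simp only [crossingPairs, List.map_cons, Sym2.map_mk, ← map_swapAt]
    rw [ih fun j hj => by simpa using hw j (by simp [hj])]
    simp [hi, hi']

theorem ProperFrom.add_one_lt {σ : List Bool} {w : List ℕ} (hw : ProperFrom σ w) :
    ∀ i ∈ w, i + 1 < σ.length := by
  induction w generalizing σ with
  | nil => simp
  | cons i w ih =>
    intro j hj
    rcases List.mem_cons.1 hj with rfl | hj
    · exact add_one_lt_of_proper hw.1
    · simpa using ih hw.2 j hj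

theorem isMinimal_prune {B : CrossbarWeb} (hB : B.IsMinimal) {P : ℕ → ℕ → Prop}
    (hP : ∀ l ≤ B.bars.length, IsGapSet (P l) B.index)
    (hs : ∀ l < B.bars.length, GapStep (P l) (P (l + 1)) (B.bar l)) :
    (CrossbarWeb.mk (twist (P 0) B.plusSig) (prune P B.bars)).IsMinimal := by
  refine ⟨ProperFrom.prune hP hs hB.1, ?_⟩
  have hi := ProperFrom.add_one_lt hB.1
  have hP0 : IsGapSet (P 0) (List.range B.index).length := by simpa using hP 0 (by simp)
  have hi' : ∀ i ∈ B.bars, i + 1 < (List.range B.index).length := by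
    simpa [index] using hi
  have h := (crossingPairs_prune (π := List.range B.index) (by simpa using hP) hs hi').nodup hB.2
  -- The twisted initial arrangement is a relabelling of the standard one, and distinctness of the
  -- relabelled pairs implies distinctness of the pairs.
  have e : twist (P 0) (List.range B.index) = (List.range B.index).map (twistIndex (P 0)) := by
    refine List.ext_getElem? fun j => ?_
    rw [getElem?_twist hP0]
    by_cases hj : j < B.index
    · have := (hP 0 (by simp)).twistIndex_lt hj
      simp [hj, this]
    · simp [hj, (hP 0 (by simp)).twistIndex_of_le (not_lt.1 hj)]
  have hi'' : ∀ i ∈ prune P B.bars, i + 1 < (List.range B.index).length := by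
    have := ProperFrom.add_one_lt (ProperFrom.prune hP hs hB.1)
    simpa [index] using this
  rw [e, crossingPairs_map _ hi''] at h
  have : (CrossbarWeb.mk (twist (P 0) B.plusSig) (prune P B.bars)).index = B.index := by
    simp [index]
  rw [this]
  exact h.of_map _

end Lists

/-! ### Minimal crossbar webs between two words with the same signs. -/

section Words

open CrossbarWeb

theorem properFrom_append {σ : List Bool} {v w : List ℕ} :
    ProperFrom σ (v ++ w) ↔
      ProperFrom σ v ∧ ProperFrom (v.foldl (fun σ i => swapAt i σ) σ) w := by
  induction v generalizing σ with
  | nil => simp [ProperFrom]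
  | cons i v ih => simp [ProperFrom, ih, and_assoc]

theorem crossingPairs_append (π v w : List ℕ) :
    crossingPairs π (v ++ w) =
      crossingPairs π v ++ crossingPairs (v.foldl (fun σ i => swapAt i σ) π) w := by
  induction v generalizing π with
  | nil => rfl
  | cons i v ih => simp [crossingPairs, ih]

theorem foldl_map_succ {α : Type*} (a : α) (σ : List α) (w : List ℕ) :
    (w.map (· + 1)).foldl (fun σ i => swapAt i σ) (a :: σ) =
      a :: w.foldl (fun σ i => swapAt i σ) σ := by
  induction w generalizing σ with
  | nil => rfl
  | cons i w ih => simp [swapAt, ih]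

theorem properFrom_map_succ {a : Bool} {σ : List Bool} {w : List ℕ} :
    ProperFrom (a :: σ) (w.map (· + 1)) ↔ ProperFrom σ w := by
  induction w generalizing σ with
  | nil => simp [ProperFrom]
  | cons i w ih => simp [ProperFrom, swapAt, ih]

theorem crossingPairs_map_succ (x : ℕ) (π w : List ℕ) :
    crossingPairs (x :: π) (w.map (· + 1)) = crossingPairs π w := by
  induction w generalizing π with
  | nil => rfl
  | cons i w ih => simp [crossingPairs, swapAt, ih]

/-- A strand of given direction can be moved to the front crossing only strands of the opposite
direction, each of them once. -/
theorem exists_word_move_front {a : Bool} {σ : List Bool} {π : List ℕ} (ha : a ∈ σ)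
    (hl : π.length = σ.length) (hπ : π.Nodup) :
    ∃ w σ' x π', ProperFrom σ w ∧ w.foldl (fun σ i => swapAt i σ) σ = a :: σ' ∧
      w.foldl (fun σ i => swapAt i σ) π = x :: π' ∧ (crossingPairs π w).Nodup ∧
      ∀ p ∈ crossingPairs π w, x ∈ p ∧ ∀ y ∈ p, y ∈ π := by
  induction σ generalizing π with
  | nil => simp at ha
  | cons b σ ih =>
    rcases π with _ | ⟨y, π⟩
    · simp at hl
    by_cases hb : b = a
    · subst hb
      exact ⟨[], σ, y, π, trivial, rfl, rfl, by simp [crossingPairs], by simp [crossingPairs]⟩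
    have ha' : a ∈ σ := by simpa [Ne.symm hb] using ha
    obtain ⟨w, σ', x, π', h₁, h₂, h₃, h₄, h₅⟩ := ih ha' (by simpa using hl) hπ.of_cons
    -- First bring the strand to the second place within the tail, then let it cross the front
    -- strand, which has the opposite direction because `b ≠ a`.
    refine ⟨w.map (· + 1) ++ [0], b :: σ', x, y :: π', ?_, ?_, ?_, ?_, ?_⟩
    · rw [properFrom_append, properFrom_map_succ, foldl_map_succ, h₂]
      refine ⟨h₁, ⟨b, rfl, ?_⟩, trivial⟩
      cases a <;> cases b <;> simp_all
    · rw [List.foldl_append, foldl_map_succ, h₂]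
      rfl
    · rw [List.foldl_append, foldl_map_succ, h₃]
      rfl
    · rw [crossingPairs_append, crossingPairs_map_succ, foldl_map_succ, h₃]
      refine h₄.append (by simp [crossingPairs]) ?_
      intro p hp hp'
      simp only [crossingPairs, List.getD_cons_zero, List.mem_singleton] at hp'
      subst hp'
      exact (List.nodup_cons.1 hπ).1 ((h₅ _ hp).2 y (by simp))
    · have hx : x ∈ π := (foldl_swapAt_perm w π).subset (by simp [h₃])
      rw [crossingPairs_append, crossingPairs_map_succ, foldl_map_succ, h₃]
      intro p hp
      rcases List.mem_append.1 hp with hp | hp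
      · exact ⟨(h₅ p hp).1, fun z hz => List.mem_cons_of_mem _ ((h₅ p hp).2 z hz)⟩
      · simp only [crossingPairs, List.mem_singleton] at hp
        subst hp
        simp [hx]

/-- Bring the required first strand to the front and recurse on the remaining ones. All crossings of
the first stage involve that strand and no later ones do, so no pair crosses twice. -/
theorem exists_word_of_perm {σ ρ : List Bool} {π : List ℕ} (h : σ.Perm ρ)
    (hl : π.length = σ.length) (hπ : π.Nodup) :
    ∃ w, ProperFrom σ w ∧ w.foldl (fun σ i => swapAt i σ) σ = ρ ∧ (crossingPairs π w).Nodup ∧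
      ∀ p ∈ crossingPairs π w, ∀ y ∈ p, y ∈ π := by
  induction ρ generalizing σ π with
  | nil =>
    obtain rfl := h.eq_nil
    exact ⟨[], trivial, rfl, by simp [crossingPairs], by simp [crossingPairs]⟩
  | cons a ρ ih =>
    obtain ⟨v, σ', x, π', h₁, h₂, h₃, h₄, h₅⟩ :=
      exists_word_move_front (h.mem_iff.2 (by simp : a ∈ a :: ρ)) hl hπ
    have hσ : (a :: σ').Perm σ := h₂ ▸ foldl_swapAt_perm v σ
    have hπ' : (x :: π').Perm π := h₃ ▸ foldl_swapAt_perm v π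
    have hn : (x :: π').Nodup := hπ'.nodup_iff.2 hπ
    obtain ⟨w, h₁', h₂', h₄', h₅'⟩ := ih (hσ.trans h).cons_inv
      (Nat.succ_injective (hπ'.length_eq.trans (hl.trans hσ.length_eq.symm))) hn.of_cons
    refine ⟨v ++ w.map (· + 1), ?_, ?_, ?_, ?_⟩
    · rw [properFrom_append, h₂, properFrom_map_succ]
      exact ⟨h₁, h₁'⟩
    · rw [List.foldl_append, h₂, foldl_map_succ, h₂']
    · rw [crossingPairs_append, h₃, crossingPairs_map_succ]
      refine h₄.append h₄' fun p hp hp' => ?_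
      exact (List.nodup_cons.1 hn).1 (h₅' p hp' x (h₅ p hp).1)
    · rw [crossingPairs_append, h₃, crossingPairs_map_succ]
      intro p hp y hy
      rcases List.mem_append.1 hp with hp | hp
      · exact (h₅ p hp).2 y hy
      · exact hπ'.subset (List.mem_cons_of_mem _ (h₅' p hp y hy))

theorem exists_isMinimal {σ ρ : List Bool} (h : σ.Perm ρ) :
    ∃ B : CrossbarWeb, B.IsMinimal ∧ B.plusSig = σ ∧ B.minusSig = ρ := by
  obtain ⟨w, h₁, h₂, h₃, -⟩ := exists_word_of_perm (π := List.range σ.length) h (by simp)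
    List.nodup_range
  exact ⟨⟨σ, w⟩, ⟨h₁, h₃⟩, rfl, h₂⟩

end Words

/-! ### Cells and regions: validity and finiteness. -/

variable {Face Edge : Type*} {𝒯 : IdealTriangulation Face Edge}

namespace LocalWeb

theorem length_sideWord (t : TriangleWeb) (k : Fin 3) :
    (t.sideWord k).length = (t.arcs (k + 2)).length + t.degree.natAbs + (t.arcs k).length := by
  simp [TriangleWeb.sideWord, add_assoc]

theorem length_minusSig (B : CrossbarWeb) : B.minusSig.length = B.index := by
  simp [CrossbarWeb.minusSig, CrossbarWeb.index]

theorem index_eq (W : LocalWeb 𝒯) {T : Face} {k : Fin 3} {γ : Edge} {b : Bool}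
    (h : 𝒯.side (T, k) = (γ, b)) : (W.bigon γ).index = ((W.face T).sideWord k).length := by
  cases b
  · rw [← length_minusSig, W.match_minus T k γ h]
    simp
  · rw [CrossbarWeb.index, W.match_plus T k γ h]

theorem sum_single_add_single (k : Fin 3) (x y : ℕ) (a : Fin 3 → ℕ)
    (ha : a = Pi.single (k + 2) x + Pi.single (k + 1) y) : a 0 + a 1 + a 2 = x + y := by
  subst ha
  fin_cases k <;> simp <;> omega

theorem isCell_sideCell (W : LocalWeb 𝒯) {T : Face} {k : Fin 3} {j : ℕ}
    (hj : j ≤ ((W.face T).sideWord k).length) : W.IsCell (W.sideCell T k j) := by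
  have := length_sideWord (W.face T) k
  simp only [sideCell]
  split_ifs with h₁ h₂
  · exact h₁
  · simp only [IsCell]
    rw [sum_single_add_single k _ _ _ rfl]
    omega
  · simp only [IsCell]
    omega

theorem isCell_bigonSideCell (W : LocalWeb 𝒯) {γ : Edge} {b : Bool} {g : ℕ}
    (hg : g ≤ (W.bigon γ).index) : W.IsCell (W.bigonSideCell γ b g) := by
  refine ⟨hg, ?_⟩
  split_ifs <;> simp

theorem isCell_seamEnds (W : LocalWeb 𝒯) {s : Seam Face Edge} (hs : W.IsSeam s) :
    W.IsCell (W.seamEnds s).1 ∧ W.IsCell (W.seamEnds s).2 := by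
  rcases s with ⟨γ, g, l⟩ | ⟨T, k, j⟩
  · obtain ⟨h₁, h₂, h₃⟩ := hs
    exact ⟨⟨h₁, h₂.le⟩, ⟨h₁, h₂⟩⟩
  · refine ⟨W.isCell_sideCell hs, W.isCell_bigonSideCell ?_⟩
    have hs : j ≤ _ := hs
    rw [W.index_eq (b := (𝒯.side (T, k)).2) rfl]
    split_ifs <;> omega

theorem IsRegion.isCell {W : LocalWeb 𝒯} {R : Set (Cell Face Edge)} (hR : W.IsRegion R)
    {c : Cell Face Edge} (hc : c ∈ R) : W.IsCell c := by
  obtain ⟨c₀, h₀, rfl⟩ := hR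
  have key : ∀ a b, Relation.EqvGen W.Adjacent a b → (W.IsCell a ↔ W.IsCell b) := by
    intro a b h
    induction h with
    | rel a b h =>
      obtain ⟨s, hs, e⟩ := h
      have := W.isCell_seamEnds hs
      rw [e] at this
      exact iff_of_true this.1 this.2
    | refl => exact Iff.rfl
    | symm _ _ _ ih => exact ih.symm
    | trans _ _ _ _ _ ih ih' => exact ih.trans ih'
  exact (key _ _ hc).1 h₀

theorem IsRegion.seamEnds_mem_iff {W : LocalWeb 𝒯} {R : Set (Cell Face Edge)} (hR : W.IsRegion R)
    {s : Seam Face Edge} (hs : W.IsSeam s) : (W.seamEnds s).1 ∈ R ↔ (W.seamEnds s).2 ∈ R := by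
  obtain ⟨c₀, h₀, rfl⟩ := hR
  have h : Relation.EqvGen W.Adjacent (W.seamEnds s).1 (W.seamEnds s).2 := .rel _ _ ⟨s, hs, rfl⟩
  exact ⟨fun h' => h'.trans _ _ _ h, fun h' => h'.trans _ _ _ (h.symm _ _)⟩

theorem finite_isVertex [Finite Face] [Finite Edge] (W : LocalWeb 𝒯) :
    {v | W.IsVertex v}.Finite := by
  have h : {v | W.IsVertex v} ⊆
      (⋃ γ : Edge, ⋃ e : Bool, (fun l => Vertex.bar γ l e) '' Set.Iio (W.bigon γ).bars.length) ∪
      (⋃ T : Face, Vertex.up T '' Set.Iic fun _ => (W.face T).degree.natAbs) ∪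
      ⋃ T : Face, Vertex.down T '' Set.Iic fun _ => (W.face T).degree.natAbs := by
    rintro (⟨γ, l, e⟩ | ⟨T, s⟩ | ⟨T, s⟩) hv
    · refine .inl (.inl ?_)
      simp only [Set.mem_iUnion]
      exact ⟨γ, e, l, hv, rfl⟩
    · have hv : s 0 + s 1 + s 2 + 1 = _ := hv
      refine .inl (.inr (Set.mem_iUnion.2 ⟨T, s, fun i => ?_, rfl⟩))
      fin_cases i <;> simp <;> omega
    · have hv : s 0 + s 1 + s 2 + 2 = _ := hv
      refine .inr (Set.mem_iUnion.2 ⟨T, s, fun i => ?_, rfl⟩)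
      fin_cases i <;> simp <;> omega
  refine Set.Finite.subset (Set.Finite.union (Set.Finite.union ?_ ?_) ?_) h
  · exact Set.finite_iUnion fun γ => Set.finite_iUnion fun e => (Set.finite_Iio _).image _
  · exact Set.finite_iUnion fun T => (Set.finite_Iic _).image _
  · exact Set.finite_iUnion fun T => (Set.finite_Iic _).image _

theorem finite_isSeam [Finite Face] [Finite Edge] (W : LocalWeb 𝒯) :
    {s | W.IsSeam s}.Finite := by
  have h : {s | W.IsSeam s} ⊆
      (⋃ γ : Edge, (fun x : ℕ × ℕ => Seam.level γ x.1 x.2) ''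
        (Set.Iic (W.bigon γ).index ×ˢ Set.Iio (W.bigon γ).bars.length)) ∪
      ⋃ T : Face, ⋃ k : Fin 3, Seam.wall T k '' Set.Iic ((W.face T).sideWord k).length := by
    rintro (⟨γ, g, l⟩ | ⟨T, k, j⟩) hs
    · exact .inl (Set.mem_iUnion.2 ⟨γ, (g, l), ⟨hs.1, hs.2.1⟩, rfl⟩)
    · refine .inr ?_
      simp only [Set.mem_iUnion]
      exact ⟨T, k, j, hs, rfl⟩
  refine Set.Finite.subset (Set.Finite.union ?_ ?_) h
  · exact Set.finite_iUnion fun γ => ((Set.finite_Iic _).prod (Set.finite_Iio _)).image _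
  · exact Set.finite_iUnion fun T => Set.finite_iUnion fun k => (Set.finite_Iic _).image _

theorem finite_corners [Finite Face] [Finite Edge] (W : LocalWeb 𝒯) (R : Set (Cell Face Edge)) :
    (W.corners R).Finite :=
  (W.finite_isVertex.prod (Set.finite_univ (α := Fin 3))).subset fun _ hx => ⟨hx.1, trivial⟩

theorem finite_seams [Finite Face] [Finite Edge] (W : LocalWeb 𝒯) (R : Set (Cell Face Edge)) :
    (W.seams R).Finite :=
  W.finite_isSeam.subset fun _ hx => hx.1

theorem finite_boundarySegments [Finite Edge] (W : LocalWeb 𝒯)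
    (R : Set (Cell Face Edge)) : (W.boundarySegments R).Finite := by
  have h : W.boundarySegments R ⊆ ⋃ γ : Edge, ⋃ b : Bool,
      (fun g => (γ, b, g)) '' Set.Iic (W.bigon γ).index := by
    rintro ⟨γ, b, g⟩ hx
    simp only [Set.mem_iUnion]
    exact ⟨γ, b, g, hx.2.1, rfl⟩
  exact (Set.finite_iUnion fun γ => Set.finite_iUnion fun b => (Set.finite_Iic _).image _).subset h

/-! ### The token count and the Euler characteristic. -/

/-- The tokens of a web: its corners, two copies of every boundary segment and two copies of each
end of every seam. -/
abbrev Token (Face Edge : Type*) :=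
  (Vertex Face Edge × Fin 3) ⊕ ((Edge × Bool × ℕ) × Bool) ⊕ (Seam Face Edge × Bool × Bool)

/-- The tokens that are there. -/
def IsToken (W : LocalWeb 𝒯) : Token Face Edge → Prop
  | .inl x => W.IsVertex x.1
  | .inr (.inl (x, _)) => (x.1, x.2.1) ∉ Set.range 𝒯.side ∧ x.2.2 ≤ (W.bigon x.1).index
  | .inr (.inr (s, _, _)) => W.IsSeam s

/-- The cell of a token. -/
def tokenCell (W : LocalWeb 𝒯) : Token Face Edge → Cell Face Edge
  | .inl x => W.cornerCell x.1 x.2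
  | .inr (.inl (x, _)) => W.bigonSideCell x.1 x.2.1 x.2.2
  | .inr (.inr (s, false, _)) => (W.seamEnds s).1
  | .inr (.inr (s, true, _)) => (W.seamEnds s).2

/-- The tokens in a set of cells. -/
def tokens (W : LocalWeb 𝒯) (R : Set (Cell Face Edge)) : Set (Token Face Edge) :=
  {x | W.IsToken x ∧ W.tokenCell x ∈ R}

theorem tokens_eq {W : LocalWeb 𝒯} {R : Set (Cell Face Edge)} (hR : W.IsRegion R) :
    W.tokens R = Sum.inl '' W.corners R ∪
      (Sum.inr '' (Sum.inl '' (W.boundarySegments R ×ˢ Set.univ)) ∪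
        Sum.inr '' (Sum.inr '' (W.seams R ×ˢ Set.univ))) := by
  ext x
  rcases x with x | ⟨x, b⟩ | ⟨s, b, c⟩
  · simp [tokens, IsToken, tokenCell, corners]
  · constructor
    · exact fun h => .inr (.inl ⟨_, ⟨(x, b), ⟨⟨h.1.1, h.1.2, h.2⟩, trivial⟩, rfl⟩, rfl⟩)
    · rintro (⟨_, -, h⟩ | ⟨_, ⟨_, ⟨h, -⟩, rfl⟩, h'⟩ | ⟨_, ⟨_, -, rfl⟩, h'⟩)
      · simp at h
      · obtain rfl := Sum.inl_injective (Sum.inr_injective h')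
        exact ⟨⟨h.1, h.2.1⟩, h.2.2⟩
      · simp at h'
  · have h : W.IsSeam s → ((W.seamEnds s).1 ∈ R ↔ (W.seamEnds s).2 ∈ R) := hR.seamEnds_mem_iff
    have h₂ : Sum.inr (Sum.inr (s, b, c)) ∈ W.tokens R ↔ s ∈ W.seams R := by
      cases b
      · simp only [tokens, IsToken, tokenCell, seams, Set.mem_ofPred_eq]
      · simp only [tokens, IsToken, tokenCell, seams, Set.mem_ofPred_eq]
        tauto
    rw [h₂]
    constructor
    · exact fun h => .inr (.inr ⟨_, ⟨(s, b, c), ⟨h, trivial⟩, rfl⟩, rfl⟩)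
    · rintro (⟨_, -, h⟩ | ⟨_, ⟨_, -, rfl⟩, h'⟩ | ⟨_, ⟨_, ⟨h, -⟩, rfl⟩, h'⟩)
      · simp at h
      · simp at h'
      · obtain rfl := Sum.inr_injective (Sum.inr_injective h')
        exact h

/-- A region contains both ends of each of its seams, and each end carries two tokens; hence the
coefficient 4. -/
theorem ncard_tokens [Finite Face] [Finite Edge] {W : LocalWeb 𝒯} {R : Set (Cell Face Edge)}
    (hR : W.IsRegion R) : (W.tokens R).Finite ∧ (W.tokens R).ncard =
      (W.corners R).ncard + 2 * (W.boundarySegments R).ncard + 4 * (W.seams R).ncard := by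
  have h₁ := (W.finite_corners R).image (Sum.inl (β := ((Edge × Bool × ℕ) × Bool) ⊕
    (Seam Face Edge × Bool × Bool)))
  have h₂ := ((((W.finite_boundarySegments R).prod (Set.finite_univ (α := Bool))).image
    (Sum.inl (β := Seam Face Edge × Bool × Bool)))).image (Sum.inr (α := Vertex Face Edge × Fin 3))
  have h₃ := ((((W.finite_seams R).prod (Set.finite_univ (α := Bool × Bool))).image
    (Sum.inr (α := (Edge × Bool × ℕ) × Bool)))).image (Sum.inr (α := Vertex Face Edge × Fin 3))
  rw [tokens_eq hR]
  refine ⟨h₁.union (h₂.union h₃), ?_⟩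
  rw [Set.ncard_union_eq ?_ h₁ (h₂.union h₃), Set.ncard_union_eq ?_ h₂ h₃,
    Set.ncard_image_of_injective _ Sum.inl_injective,
    Set.ncard_image_of_injective _ Sum.inr_injective,
    Set.ncard_image_of_injective _ Sum.inl_injective,
    Set.ncard_image_of_injective _ Sum.inr_injective,
    Set.ncard_image_of_injective _ Sum.inr_injective, Set.ncard_prod, Set.ncard_prod]
  · simp [Set.ncard_univ]
    ring
  · rw [Set.disjoint_left]
    rintro _ ⟨_, ⟨x, -, rfl⟩, rfl⟩ ⟨_, ⟨y, -, rfl⟩, h⟩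
    simp at h
  · rw [Set.disjoint_left]
    rintro _ ⟨x, -, rfl⟩ (⟨y, -, h⟩ | ⟨y, -, h⟩) <;> simp at h

/-- If every cell of a region has at least four tokens, then the total number of tokens controls
those of each cell. -/
theorem ncard_tokens_add_le [Finite Face] [Finite Edge] {W : LocalWeb 𝒯} {R : Set (Cell Face Edge)}
    (hR : W.IsRegion R) (hf : R.Finite) (h : ∀ c ∈ R, 4 ≤ (W.tokens {c}).ncard)
    {c : Cell Face Edge} (hc : c ∈ R) :
    4 * R.ncard + (W.tokens {c}).ncard ≤ (W.tokens R).ncard + 4 := by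
  classical
  have hfin := (ncard_tokens hR).1
  have hcell : ∀ c ∈ R, (W.tokens {c}).ncard =
      (hfin.toFinset.filter fun x => W.tokenCell x = c).card := by
    intro c hc
    rw [← Set.ncard_coe_finset]
    congr 1
    ext x
    simp only [tokens, Set.mem_singleton_iff, Set.mem_ofPred_eq, Finset.coe_filter,
      Set.Finite.mem_toFinset]
    constructor
    · rintro ⟨h, rfl⟩
      exact ⟨⟨h, hc⟩, rfl⟩
    · rintro ⟨⟨h, -⟩, h'⟩
      exact ⟨h, h'⟩
  rw [Set.ncard_eq_toFinset_card _ hfin, Set.ncard_eq_toFinset_card _ hf,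
    Finset.card_eq_sum_card_fiberwise (f := W.tokenCell) (t := hf.toFinset)
      (by intro x hx; simpa using ((hfin.mem_toFinset).1 hx).2),
    ← Finset.sum_erase_add _ _ (hf.mem_toFinset.2 hc), ← hcell c hc]
  have h4 : ∀ c' ∈ hf.toFinset.erase c,
      4 ≤ (hfin.toFinset.filter fun x => W.tokenCell x = c').card := by
    intro c' hc'
    have hc' : c' ∈ R := by simpa using Finset.mem_of_mem_erase hc'
    rw [← hcell c' hc']
    exact h c' hc'
  have := Finset.card_nsmul_le_sum _ _ _ h4
  rw [Finset.card_erase_of_mem (hf.mem_toFinset.2 hc), smul_eq_mul] at this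
  have hpos : 0 < hf.toFinset.card := Finset.card_pos.2 ⟨c, hf.mem_toFinset.2 hc⟩
  omega

/-- For a token of a bigon cell: whether it lies on the `∂₊`-side (`1`) or the `∂₋`-side (`0`) of
the cell, or laterally (`2`). -/
def tokenTag (𝒯 : IdealTriangulation Face Edge) : Token Face Edge → ℕ
  | .inl x => x.2
  | .inr (.inl (x, _)) => if x.2.1 then 1 else 0
  | .inr (.inr (.level _ _ _, b, _)) => if b then 1 else 0
  | .inr (.inr (.wall T k _, _, _)) => if (𝒯.side (T, k)).2 then 1 else 0

/-- Towards `∂₊` a bigon cell ends at a wall, at a boundary segment, at a level or at a crossbar.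
Each of the first three carries two tokens, and a crossbar contributes the corners at its two ends.
-/
theorem exists_tokens_plus (W : LocalWeb 𝒯) {γ : Edge} {g l : ℕ} (hg' : g ≤ (W.bigon γ).index)
    (hl : l ≤ (W.bigon γ).bars.length) :
    ∃ x y, x ≠ y ∧ x ∈ W.tokens {.bigon γ g l} ∧ y ∈ W.tokens {.bigon γ g l} ∧
      tokenTag 𝒯 x = 1 ∧ tokenTag 𝒯 y = 1 := by
  rcases l with _ | l
  · by_cases h : (γ, true) ∈ Set.range 𝒯.side
    · obtain ⟨⟨T, k⟩, h⟩ := h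
      have hs : g ≤ ((W.face T).sideWord k).length := by rwa [← W.index_eq h]
      refine ⟨.inr (.inr (.wall T k g, true, true)), .inr (.inr (.wall T k g, true, false)),
        by simp, ⟨hs, ?_⟩, ⟨hs, ?_⟩, ?_, ?_⟩ <;>
        simp [tokenCell, seamEnds, h, bigonSideCell, tokenTag]
    · refine ⟨.inr (.inl ((γ, true, g), true)), .inr (.inl ((γ, true, g), false)),
        by simp, ⟨⟨h, hg'⟩, ?_⟩, ⟨⟨h, hg'⟩, ?_⟩, ?_, ?_⟩ <;>
        simp [tokenCell, bigonSideCell, tokenTag]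
  · by_cases h : (W.bigon γ).bar l + 1 = g
    · refine ⟨.inl (.bar γ l true, 1), .inl (.bar γ l false, 1), by simp, ⟨hl, ?_⟩, ⟨hl, ?_⟩,
        rfl, rfl⟩ <;> simp [tokenCell, cornerCell, h]
    · refine ⟨.inr (.inr (.level γ g l, true, true)), .inr (.inr (.level γ g l, true, false)),
        by simp, ⟨⟨hg', hl, h⟩, rfl⟩, ⟨⟨hg', hl, h⟩, rfl⟩, ?_, ?_⟩ <;> simp [tokenTag]

theorem exists_tokens_minus (W : LocalWeb 𝒯) {γ : Edge} {g l : ℕ} (hg' : g ≤ (W.bigon γ).index)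
    (hl : l ≤ (W.bigon γ).bars.length) :
    ∃ x y, x ≠ y ∧ x ∈ W.tokens {.bigon γ g l} ∧ y ∈ W.tokens {.bigon γ g l} ∧
      tokenTag 𝒯 x = 0 ∧ tokenTag 𝒯 y = 0 := by
  rcases hl.eq_or_lt with rfl | hl
  · by_cases h : (γ, false) ∈ Set.range 𝒯.side
    · obtain ⟨⟨T, k⟩, h⟩ := h
      have hi := W.index_eq h
      rw [hi] at hg'
      have hs := Nat.sub_le ((W.face T).sideWord k).length g
      refine ⟨.inr (.inr (.wall T k _, true, true)), .inr (.inr (.wall T k _, true, false)),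
        by simp, ⟨hs, ?_⟩, ⟨hs, ?_⟩, ?_, ?_⟩ <;>
        simp [tokenCell, seamEnds, h, bigonSideCell, tokenTag, Nat.sub_sub_self hg']
    · refine ⟨.inr (.inl ((γ, false, g), true)), .inr (.inl ((γ, false, g), false)),
        by simp, ⟨⟨h, hg'⟩, ?_⟩, ⟨⟨h, hg'⟩, ?_⟩, ?_, ?_⟩ <;>
        simp [tokenCell, bigonSideCell, tokenTag]
  · by_cases h : (W.bigon γ).bar l + 1 = g
    · refine ⟨.inl (.bar γ l true, 0), .inl (.bar γ l false, 0), by simp, ⟨hl, ?_⟩, ⟨hl, ?_⟩,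
        rfl, rfl⟩ <;> simp [tokenCell, cornerCell, h]
    · refine ⟨.inr (.inr (.level γ g l, false, true)), .inr (.inr (.level γ g l, false, false)),
        by simp, ⟨⟨hg', hl, h⟩, rfl⟩, ⟨⟨hg', hl, h⟩, rfl⟩, ?_, ?_⟩ <;> simp [tokenTag]

theorem length_le_ncard {α : Type*} {S : Set α} (hS : S.Finite) {L : List α} (hL : L.Nodup)
    (h : ∀ x ∈ L, x ∈ S) : L.length ≤ S.ncard := by
  classical
  rw [← List.toFinset_card_of_nodup hL, ← Set.ncard_coe_finset]
  exact Set.ncard_le_ncard (by simpa [Set.subset_def] using h) hS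

theorem four_le_ncard_tokens_bigon (W : LocalWeb 𝒯) {γ : Edge} {g l : ℕ}
    (hf : (W.tokens {.bigon γ g l}).Finite) (hc : W.IsCell (.bigon γ g l)) :
    4 ≤ (W.tokens {.bigon γ g l}).ncard := by
  obtain ⟨x, y, h, hx, hy, tx, ty⟩ := W.exists_tokens_plus hc.1 hc.2
  obtain ⟨x', y', h', hx', hy', tx', ty'⟩ := W.exists_tokens_minus hc.1 hc.2
  refine length_le_ncard hf (L := [x, y, x', y']) ?_ ?_
  · simp only [List.nodup_cons, List.mem_cons, List.not_mem_nil, or_false, not_or]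
    grind
  · simp [hx, hy, hx', hy']

/-- A lateral corner has tag 2 and so differs from the four tokens at the two ends of the cell. -/
theorem five_le_ncard_tokens_bigon (W : LocalWeb 𝒯) {γ : Edge} {g l : ℕ}
    (hf : (W.tokens {.bigon γ g l}).Finite) (hc : W.IsCell (.bigon γ g l)) {v : Vertex Face Edge}
    (hv : W.IsVertex v) (h₂ : W.cornerCell v 2 = .bigon γ g l) :
    5 ≤ (W.tokens {.bigon γ g l}).ncard := by
  obtain ⟨x, y, h, hx, hy, tx, ty⟩ := W.exists_tokens_plus hc.1 hc.2
  obtain ⟨x', y', h', hx', hy', tx', ty'⟩ := W.exists_tokens_minus hc.1 hc.2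
  have hz : (.inl (v, 2) : Token Face Edge) ∈ W.tokens {.bigon γ g l} := ⟨hv, h₂⟩
  have tz : tokenTag 𝒯 (.inl (v, 2)) = 2 := rfl
  refine length_le_ncard hf (L := [.inl (v, 2), x, y, x', y']) ?_ ?_
  · simp only [List.nodup_cons, List.mem_cons, List.not_mem_nil, or_false, not_or]
    grind
  · simp [hx, hy, hx', hy', hz]

/-- The two ends of the strip at arc `t` around corner `c`. -/
theorem sideCell_strip (W : LocalWeb 𝒯) {T : Face} {c : Fin 3} {t : ℕ}
    (ht : t < ((W.face T).arcs c).length) :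
    W.sideCell T (c + 1) t = .strip T c t ∧
      W.sideCell T c (((W.face T).sideWord c).length - t) = .strip T c t := by
  have := length_sideWord (W.face T) c
  have e : c + 1 + 2 = c := by fin_cases c <;> rfl
  constructor
  · simp only [sideCell, e, ht, if_true]
  · simp only [sideCell]
    rw [if_neg (by omega), if_neg (by omega)]
    congr 1
    omega

theorem four_le_ncard_tokens_strip (W : LocalWeb 𝒯) {T : Face} {c : Fin 3} {t : ℕ}
    (hf : (W.tokens {.strip T c t}).Finite) (hc : t < ((W.face T).arcs c).length) :
    4 ≤ (W.tokens {.strip T c t}).ncard := by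
  obtain ⟨h₁, h₂⟩ := W.sideCell_strip hc
  have e : c + 1 + 2 = c := by fin_cases c <;> rfl
  have e' : c + 1 ≠ c := by fin_cases c <;> decide
  have hl := length_sideWord (W.face T) (c + 1)
  rw [e] at hl
  have hs : t ≤ ((W.face T).sideWord (c + 1)).length := by omega
  have hs' := Nat.sub_le ((W.face T).sideWord c).length t
  refine length_le_ncard hf (L := [.inr (.inr (.wall T (c + 1) t, false, false)),
    .inr (.inr (.wall T (c + 1) t, false, true)),
    .inr (.inr (.wall T c (((W.face T).sideWord c).length - t), false, false)),
    .inr (.inr (.wall T c (((W.face T).sideWord c).length - t), false, true))]) ?_ ?_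
  · simp [e']
  · simp only [List.mem_cons, List.not_mem_nil, or_false]
    rintro x (rfl | rfl | rfl | rfl)
    exacts [⟨hs, h₁⟩, ⟨hs, h₁⟩, ⟨hs', h₂⟩, ⟨hs', h₂⟩]

/-- A pyramid cell touching side `k` has a seam there. -/
theorem exists_wall_comb (W : LocalWeb 𝒯) {T : Face} {a : Fin 3 → ℕ} (hc : W.IsCell (.comb T a))
    {k : Fin 3} (hk : a k = 0) :
    ∃ j, ∀ b, (.inr (.inr (.wall T k j, false, b)) : Token Face Edge) ∈ W.tokens {.comb T a} := by
  have hs : a 0 + a 1 + a 2 = (W.face T).degree.natAbs := hc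
  have hl := length_sideWord (W.face T) k
  have hs' : a (k + 1) + a (k + 2) = (W.face T).degree.natAbs := by
    fin_cases k <;> simp at hk ⊢ <;> omega
  refine ⟨((W.face T).arcs (k + 2)).length + a (k + 2), fun b => ⟨?_, ?_⟩⟩
  · change _ ≤ _
    omega
  · simp only [tokenCell, seamEnds, sideCell, Set.mem_singleton_iff]
    rw [if_neg (by omega), if_pos (by omega), ← hs']
    congr 1
    rw [show ((W.face T).arcs (k + 2)).length + a (k + 2) - ((W.face T).arcs (k + 2)).length =
      a (k + 2) by omega, show ((W.face T).arcs (k + 2)).length + (a (k + 1) + a (k + 2)) -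
      (((W.face T).arcs (k + 2)).length + a (k + 2)) = a (k + 1) by omega]
    ext i
    fin_cases k <;> fin_cases i <;> simp at hk ⊢ <;> omega

theorem up_mem_tokens (W : LocalWeb 𝒯) {T : Face} {a : Fin 3 → ℕ} (hc : W.IsCell (.comb T a))
    {k : Fin 3} (hk : a k ≠ 0) :
    (.inl (.up T (a - Pi.single k 1), k) : Token Face Edge) ∈ W.tokens {.comb T a} := by
  have hs : a 0 + a 1 + a 2 = (W.face T).degree.natAbs := hc
  refine ⟨?_, ?_⟩
  · simp only [IsToken, IsVertex]
    fin_cases k <;> simp at hk ⊢ <;> omega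
  · simp only [tokenCell, cornerCell, Set.mem_singleton_iff]
    congr 1
    ext i
    by_cases h : i = k
    · subst h
      simp
      omega
    · simp [h]

theorem down_mem_tokens (W : LocalWeb 𝒯) {T : Face} {a : Fin 3 → ℕ} (hc : W.IsCell (.comb T a))
    {k : Fin 3} (hk : a (k + 1) ≠ 0) (hk' : a (k + 2) ≠ 0) :
    (.inl (.down T (a - Pi.single (k + 1) 1 - Pi.single (k + 2) 1), k) : Token Face Edge) ∈
      W.tokens {.comb T a} := by
  have hs : a 0 + a 1 + a 2 = (W.face T).degree.natAbs := hc
  refine ⟨?_, ?_⟩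
  · simp only [IsToken, IsVertex]
    fin_cases k <;> simp at hk hk' ⊢ <;> omega
  · simp only [tokenCell, cornerCell, Set.mem_singleton_iff]
    congr 1
    ext i
    fin_cases k <;> fin_cases i <;> simp at hk hk' ⊢ <;> omega

/-- Every zero coordinate yields a wall with two tokens, every nonzero one a corner of type `up`,
and every pair of nonzero ones a corner of type `down`. For 0, 1, 2, 3 zero coordinates this makes
6, 5, 5, 6 tokens. -/
theorem five_le_ncard_tokens_comb (W : LocalWeb 𝒯) {T : Face} {a : Fin 3 → ℕ}
    (hf : (W.tokens {.comb T a}).Finite) (hc : W.IsCell (.comb T a)) :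
    5 ≤ (W.tokens {.comb T a}).ncard := by
  have key : ∀ {x₁ x₂ x₃ x₄ x₅}, x₁ ∈ W.tokens {.comb T a} → x₂ ∈ W.tokens {.comb T a} →
      x₃ ∈ W.tokens {.comb T a} → x₄ ∈ W.tokens {.comb T a} → x₅ ∈ W.tokens {.comb T a} →
      [x₁, x₂, x₃, x₄, x₅].Nodup → 5 ≤ (W.tokens {.comb T a}).ncard := by
    intro x₁ x₂ x₃ x₄ x₅ h₁ h₂ h₃ h₄ h₅ hn
    exact length_le_ncard hf hn (by simp [h₁, h₂, h₃, h₄, h₅])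
  have hw := fun k hk => W.exists_wall_comb (k := k) hc hk
  have hu := fun k hk => W.up_mem_tokens (k := k) hc hk
  have hd := fun k hk hk' => W.down_mem_tokens (k := k) hc hk hk'
  have d0 := hd 0
  have d1 := hd 1
  have d2 := hd 2
  simp only [zero_add, Fin.isValue, show (1 : Fin 3) + 1 = 2 from rfl,
    show (1 : Fin 3) + 2 = 0 from rfl, show (2 : Fin 3) + 1 = 0 from rfl,
    show (2 : Fin 3) + 2 = 1 from rfl] at d0 d1 d2
  by_cases h0 : a 0 = 0 <;> by_cases h1 : a 1 = 0 <;> by_cases h2 : a 2 = 0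
  · obtain ⟨i, hi⟩ := hw 0 h0
    obtain ⟨j, hj⟩ := hw 1 h1
    obtain ⟨k, hk⟩ := hw 2 h2
    exact key (hi true) (hi false) (hj true) (hj false) (hk true) (by simp)
  · obtain ⟨i, hi⟩ := hw 0 h0
    obtain ⟨j, hj⟩ := hw 1 h1
    exact key (hi true) (hi false) (hj true) (hj false) (hu 2 h2) (by simp)
  · obtain ⟨i, hi⟩ := hw 0 h0
    obtain ⟨j, hj⟩ := hw 2 h2
    exact key (hi true) (hi false) (hj true) (hj false) (hu 1 h1) (by simp)
  · obtain ⟨i, hi⟩ := hw 0 h0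
    exact key (hi true) (hi false) (hu 1 h1) (hu 2 h2) (d0 h1 h2) (by simp)
  · obtain ⟨i, hi⟩ := hw 1 h1
    obtain ⟨j, hj⟩ := hw 2 h2
    exact key (hi true) (hi false) (hj true) (hj false) (hu 0 h0) (by simp)
  · obtain ⟨i, hi⟩ := hw 1 h1
    exact key (hi true) (hi false) (hu 0 h0) (hu 2 h2) (d1 h2 h0) (by simp)
  · obtain ⟨i, hi⟩ := hw 2 h2
    exact key (hi true) (hi false) (hu 0 h0) (hu 1 h1) (d2 h0 h1) (by simp)
  · exact key (hu 0 h0) (hu 1 h1) (hu 2 h2) (d0 h1 h2) (d1 h2 h0) (by simp)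

theorem finite_tokens_singleton [Finite Face] [Finite Edge] {W : LocalWeb 𝒯}
    {R : Set (Cell Face Edge)} (hR : W.IsRegion R) {c : Cell Face Edge} (hc : c ∈ R) :
    (W.tokens {c}).Finite :=
  (ncard_tokens hR).1.subset fun x hx => ⟨hx.1, by rw [hx.2]; exact hc⟩

theorem four_le_ncard_tokens [Finite Face] [Finite Edge] {W : LocalWeb 𝒯}
    {R : Set (Cell Face Edge)} (hR : W.IsRegion R) {c : Cell Face Edge} (hc : c ∈ R) :
    4 ≤ (W.tokens {c}).ncard := by
  have hf := finite_tokens_singleton hR hc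
  have hv := hR.isCell hc
  rcases c with ⟨γ, g, l⟩ | ⟨T, c, t⟩ | ⟨T, a⟩
  · exact W.four_le_ncard_tokens_bigon hf hv
  · exact W.four_le_ncard_tokens_strip hf hv
  · exact le_trans (by norm_num) (W.five_le_ncard_tokens_comb hf hv)

/-- In terms of the numbers of boundary segments and corners, the Euler characteristic of a polygon
shows that it has at least four corners, and that its cells have no excess if it has just four. -/
theorem IsPolygon.four_le [Finite Face] [Finite Edge] {W : LocalWeb 𝒯} {R : Set (Cell Face Edge)}
    {m n : ℕ} (hR : W.IsPolygon R m n) :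
    4 ≤ n + 2 * m ∧ (n + 2 * m = 4 → ∀ c ∈ R, (W.tokens {c}).ncard ≤ 4) := by
  obtain ⟨h, -, hs, hm, hn⟩ := hR
  have hf : R.Finite := Set.finite_of_ncard_ne_zero (by omega)
  have key := fun c hc => ncard_tokens_add_le h hf (fun c hc => four_le_ncard_tokens h hc)
    (c := c) hc
  -- Since the number of cells exceeds that of seams by one, the terms 4 per cell and 4 per seam
  -- differ by exactly 4, which leaves `n + 2 * m` as an upper bound for the tokens of any single
  -- cell.
  rw [(ncard_tokens h).2, hs, hm, hn] at key
  obtain ⟨c, hc⟩ : R.Nonempty := (Set.ncard_pos hf).1 (by omega)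
  have := four_le_ncard_tokens h hc
  refine ⟨by have := key c hc; omega, fun _ c hc => by have := key c hc; omega⟩

end LocalWeb

/-! ### Antiparallel lines and the structure of ladders. -/

theorem IsGapSet.mono {P : ℕ → Prop} {m n : ℕ} (h : IsGapSet P m) (hmn : m ≤ n) : IsGapSet P n :=
  ⟨h.1, fun g hg => (h.2 g hg).trans_le hmn, h.3⟩

/-- The lines on both sides of gap `g` have the opposite signs `χ` and `!χ`. -/
def IsAntiparallel (χ : Bool) (σ : List Bool) (g : ℕ) : Prop :=
  0 < g ∧ σ[g - 1]? = some χ ∧ σ[g]? = some (!χ)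

theorem IsAntiparallel.lt {χ : Bool} {σ : List Bool} {g : ℕ} (h : IsAntiparallel χ σ g) :
    g < σ.length :=
  (List.getElem?_eq_some_iff.1 h.2.2).1

/-- The line shared by two neighbouring gaps would need sign `!χ` for the first and `χ` for the
second. -/
theorem isGapSet_of_isAntiparallel {χ : Bool} {σ : List Bool} {P : ℕ → Prop}
    (h : ∀ g, P g → IsAntiparallel χ σ g) : IsGapSet P σ.length where
  not_zero h0 := lt_irrefl _ (h 0 h0).1
  lt g hg := (h g hg).lt
  isolated g hg hg' := by
    have h₁ := (h g hg).2.2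
    have h₂ := (h _ hg').2.1
    rw [Nat.add_sub_cancel, h₁] at h₂
    cases χ <;> simp at h₂

theorem isAntiparallel_append_left {χ : Bool} {A B : List Bool} {g : ℕ} (hg : g < A.length) :
    IsAntiparallel χ (A ++ B) g ↔ IsAntiparallel χ A g := by
  simp only [IsAntiparallel, List.getElem?_append_left hg,
    List.getElem?_append_left (show g - 1 < A.length by omega)]

theorem isAntiparallel_append_right {χ : Bool} {A B : List Bool} {g : ℕ} (hg : 0 < g) :
    IsAntiparallel χ (A ++ B) (A.length + g) ↔ IsAntiparallel χ B g := by
  simp only [IsAntiparallel]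
  rw [List.getElem?_append_right (by omega), List.getElem?_append_right (by omega),
    show A.length + g - 1 - A.length = g - 1 by omega, Nat.add_sub_cancel_left]
  simp [hg]

/-- Reading a word from the opposite side reverses it and flips its signs. On a pair of opposite
signs the two effects cancel, so `χ` is the same on both sides of a wall. -/
theorem isAntiparallel_reverse_map_not {χ : Bool} {A : List Bool} {g : ℕ} (hg : g ≤ A.length) :
    IsAntiparallel χ (A.map (fun b => !b)).reverse g ↔ IsAntiparallel χ A (A.length - g) := by
  by_cases h₀ : g = 0
  · simp [IsAntiparallel, h₀]
  by_cases h₁ : g = A.length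
  · simp [IsAntiparallel, h₁]
  have h₂ : g - 1 < (A.map (fun b => !b)).length := by simp; omega
  have h₃ : g < (A.map (fun b => !b)).length := by simp; omega
  simp only [IsAntiparallel]
  rw [List.getElem?_reverse h₂, List.getElem?_reverse h₃, List.getElem?_map, List.getElem?_map,
    List.length_map, show A.length - 1 - (g - 1) = A.length - g by omega,
    show A.length - 1 - g = A.length - g - 1 by omega]
  have h₄ : A.length - g < A.length := by omega
  have h₅ : A.length - g - 1 < A.length := by omega
  simp only [h₄, h₅, List.getElem?_eq_getElem, Option.map_some, Option.some.injEq]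
  have h₆ : g < A.length := by omega
  have h₇ : 0 < g := by omega
  cases χ <;> simp [h₆, h₇, and_comm]

namespace LocalWeb

/-- A region consisting of strips between parallel arcs and of parts of gaps bounded laterally by
lines without vertices, at least one of which ends at a crossbar. -/
structure IsLadder (W : LocalWeb 𝒯) (R : Set (Cell Face Edge)) : Prop where
  isRegion : W.IsRegion R
  comb_notMem : ∀ T a, Cell.comb T a ∉ R
  lateral_notMem : ∀ v, W.IsVertex v → W.cornerCell v 2 ∉ R
  exists_bar : ∃ γ l, l < (W.bigon γ).bars.length ∧
    (Cell.bigon γ ((W.bigon γ).bar l + 1) l ∈ R ∨ Cell.bigon γ ((W.bigon γ).bar l + 1) (l + 1) ∈ R)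

/-- Without excess there are no pyramid cells and no lateral corners, as these force five tokens.
The four corners of the polygon must then lie at crossbars closing off gaps. -/
theorem IsPolygon.isLadder [Finite Face] [Finite Edge] {W : LocalWeb 𝒯} {R : Set (Cell Face Edge)}
    (hR : W.IsPolygon R 0 4) : W.IsLadder R := by
  have h := hR.four_le.2 rfl
  have hcomb : ∀ T a, Cell.comb T a ∉ R := fun T a hc => by
    have h₁ := h _ hc
    have h₂ := W.five_le_ncard_tokens_comb (finite_tokens_singleton hR.1 hc) (hR.1.isCell hc)
    omega
  have hl : ∀ v, W.IsVertex v → W.cornerCell v 2 ∉ R := fun v hv hc => by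
    rcases v with ⟨γ, l, e⟩ | ⟨T, s⟩ | ⟨T, s⟩
    · have h₁ := h _ hc
      exact absurd (W.five_le_ncard_tokens_bigon (finite_tokens_singleton hR.1 hc)
        (hR.1.isCell hc) hv rfl) (Nat.not_le.2 (Nat.lt_succ_of_le h₁))
    · exact hcomb _ _ hc
    · exact hcomb _ _ hc
  refine ⟨hR.1, hcomb, hl, ?_⟩
  obtain ⟨⟨v, i⟩, hv, hi⟩ : (W.corners R).Nonempty := by
    refine (Set.ncard_pos (W.finite_corners R)).1 ?_
    rw [hR.2.2.2.2]
    norm_num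
  rcases v with ⟨γ, l, e⟩ | ⟨T, s⟩ | ⟨T, s⟩
  · fin_cases i
    · exact ⟨γ, l, hv, .inl hi⟩
    · exact ⟨γ, l, hv, .inr hi⟩
    · exact (hl _ hv hi).elim
  · exact (hcomb _ _ hi).elim
  · exact (hcomb _ _ hi).elim

/-- The signs of the lines of `N(γ)` after the first `l` crossbars. -/
def signs (W : LocalWeb 𝒯) (γ : Edge) (l : ℕ) : List Bool :=
  stateAt (W.bigon γ).bars l (W.bigon γ).plusSig

theorem length_signs (W : LocalWeb 𝒯) (γ : Edge) (l : ℕ) :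
    (W.signs γ l).length = (W.bigon γ).index := by
  simp [signs, CrossbarWeb.index]

theorem signs_zero (W : LocalWeb 𝒯) (γ : Edge) : W.signs γ 0 = (W.bigon γ).plusSig := rfl

theorem signs_length (W : LocalWeb 𝒯) (γ : Edge) :
    W.signs γ (W.bigon γ).bars.length = (W.bigon γ).minusSig := by
  simp [signs, stateAt, CrossbarWeb.minusSig]

theorem exists_signs_bar (W : LocalWeb 𝒯) {γ : Edge} {l : ℕ}
    (hl : l < (W.bigon γ).bars.length) : ∃ s : Bool,
      (W.signs γ l)[(W.bigon γ).bar l]? = some s ∧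
      (W.signs γ l)[(W.bigon γ).bar l + 1]? = some (!s) :=
  (W.minimal γ).1.stateAt hl

theorem getElem?_signs_succ (W : LocalWeb 𝒯) {γ : Edge} {l : ℕ}
    (hl : l < (W.bigon γ).bars.length) (j : ℕ) : (W.signs γ (l + 1))[j]? =
      (W.signs γ l)[if j = (W.bigon γ).bar l then (W.bigon γ).bar l + 1 else
        if j = (W.bigon γ).bar l + 1 then (W.bigon γ).bar l else j]? := by
  have h := add_one_lt_of_proper (W.exists_signs_bar hl)
  rw [signs, stateAt_succ hl]
  exact getElem?_swapAt h j

/-- The web runs around the cell along the two arcs or lines bounding it laterally, in the sense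
given by `χ`. -/
def IsCoherent (W : LocalWeb 𝒯) (χ : Bool) : Cell Face Edge → Prop
  | .bigon γ g l => IsAntiparallel χ (W.signs γ l) g
  | .strip T c t => IsAntiparallel χ ((W.face T).arcs c) t
  | .comb _ _ => False

theorem isCoherent_sideCell {W : LocalWeb 𝒯} {χ : Bool} {T : Face} {k : Fin 3} {j : ℕ}
    (hj : j ≤ ((W.face T).sideWord k).length) (h : ∀ a, W.sideCell T k j ≠ .comb T a) :
    W.IsCoherent χ (W.sideCell T k j) ↔ IsAntiparallel χ ((W.face T).sideWord k) j := by
  have hl := length_sideWord (W.face T) k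
  simp only [sideCell] at h ⊢
  split_ifs at h ⊢ with h₁ h₂
  · simp only [IsCoherent, TriangleWeb.sideWord]
    rw [isAntiparallel_append_left (by simp; omega), isAntiparallel_append_left h₁]
  · exact (h _ rfl).elim
  · obtain ⟨i, rfl⟩ := Nat.exists_eq_add_of_le (not_le.1 h₂).le
    have e := isAntiparallel_append_right (χ := χ) (A := (W.face T).arcs (k + 2) ++
      List.replicate (W.face T).degree.natAbs (decide (0 < (W.face T).degree)))
      (B := (((W.face T).arcs k).map (fun b => !b)).reverse) (show 0 < i by omega)
    rw [List.length_append, List.length_replicate] at e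
    simp only [IsCoherent, TriangleWeb.sideWord]
    rw [e, isAntiparallel_reverse_map_not (by omega)]
    simp [Nat.add_sub_add_left, ← add_assoc]

/-- Across a level, the orientations of the two bounding lines can change only at a crossbar
attached to them from outside, which would be a lateral corner. Across a wall, the same two strands
continue. -/
theorem IsLadder.isCoherent_iff {W : LocalWeb 𝒯} {R : Set (Cell Face Edge)} (hR : W.IsLadder R)
    {χ : Bool} {s : Seam Face Edge} (hs : W.IsSeam s) (h : (W.seamEnds s).1 ∈ R) :
    W.IsCoherent χ (W.seamEnds s).1 ↔ W.IsCoherent χ (W.seamEnds s).2 := by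
  rcases s with ⟨γ, g, l⟩ | ⟨T, k, j⟩
  · obtain ⟨h₁, h₂, h₃⟩ := hs
    have hl : (W.bigon γ).bar l ≠ g := fun e => hR.lateral_notMem (.bar γ l false) h₂ <| by
      simpa [cornerCell, e, seamEnds] using h
    have hr : (W.bigon γ).bar l + 2 ≠ g := fun e => hR.lateral_notMem (.bar γ l true) h₂ <| by
      simpa [cornerCell, e, seamEnds] using h
    simp only [seamEnds, IsCoherent, IsAntiparallel]
    rw [W.getElem?_signs_succ h₂, W.getElem?_signs_succ h₂]
    refine and_congr_right fun h₀ => ?_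
    rw [if_neg (by omega), if_neg (by omega), if_neg (by omega), if_neg (by omega)]
  · have hj : j ≤ ((W.face T).sideWord k).length := hs
    simp only [seamEnds] at h ⊢
    rw [isCoherent_sideCell hj fun a e => hR.comb_notMem T a (e ▸ h)]
    rcases hγ : 𝒯.side (T, k) with ⟨γ, _ | _⟩
    · simp only [bigonSideCell, IsCoherent, Bool.false_eq_true, if_false]
      rw [signs_length, W.match_minus T k γ hγ, isAntiparallel_reverse_map_not (by omega)]
      rw [Nat.sub_sub_self hj]
    · simp only [bigonSideCell, IsCoherent, if_true]
      rw [signs_zero, W.match_plus T k γ hγ]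

/-- The two lines joined by a crossbar have opposite signs, so some cell at the end of the ladder is
coherent, and coherence propagates through the connected region. A single `χ` on the whole region is
what keeps distinct passages of the ladder through one bigon or corner from sharing a line; it also
excludes the outer gaps. -/
theorem IsLadder.exists_isCoherent {W : LocalWeb 𝒯} {R : Set (Cell Face Edge)}
    (hR : W.IsLadder R) : ∃ χ, ∀ c ∈ R, W.IsCoherent χ c := by
  obtain ⟨c₀, hc₀, χ, h₀⟩ : ∃ c₀ ∈ R, ∃ χ, W.IsCoherent χ c₀ := by
    obtain ⟨γ, l, hl, h⟩ := hR.exists_bar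
    obtain ⟨s, h₁, h₂⟩ := W.exists_signs_bar hl
    rcases h with h | h
    · exact ⟨_, h, s, Nat.succ_pos _, h₁, h₂⟩
    -- Below the crossbar the two signs are interchanged.
    · refine ⟨_, h, !s, Nat.succ_pos _, ?_, ?_⟩
      · rw [W.getElem?_signs_succ hl]
        simp [h₂]
      · rw [W.getElem?_signs_succ hl]
        simp [h₁]
  have key : ∀ a b, Relation.EqvGen W.Adjacent a b →
      ((a ∈ R ↔ b ∈ R) ∧ (a ∈ R → (W.IsCoherent χ a ↔ W.IsCoherent χ b))) := by
    intro a b h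
    induction h with
    | rel a b h =>
      obtain ⟨s, hs, e⟩ := h
      have h₁ := hR.isRegion.seamEnds_mem_iff hs
      have h₂ := hR.isCoherent_iff (χ := χ) hs
      rw [e] at h₁ h₂
      exact ⟨h₁, h₂⟩
    | refl => exact ⟨Iff.rfl, fun _ => Iff.rfl⟩
    | symm _ _ _ ih => exact ⟨ih.1.symm, fun h => (ih.2 (ih.1.2 h)).symm⟩
    | trans _ _ _ _ _ ih ih' => exact ⟨ih.1.trans ih'.1, fun h => (ih.2 h).trans (ih'.2 (ih.1.1 h))⟩
  refine ⟨χ, fun c hc => ?_⟩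
  obtain ⟨c₁, -, e⟩ := hR.isRegion
  have h₁ : Relation.EqvGen W.Adjacent c₁ c₀ := by rw [e] at hc₀; exact hc₀
  have h₂ : Relation.EqvGen W.Adjacent c₁ c := by rw [e] at hc; exact hc
  exact ((key c₀ c ((h₁.symm _ _).trans _ _ _ h₂)).2 hc₀).1 h₀

variable {W : LocalWeb 𝒯} {R : Set (Cell Face Edge)}

theorem IsLadder.isGapSet_bigon (hR : W.IsLadder R) (γ : Edge) (l : ℕ) :
    IsGapSet (fun g => Cell.bigon γ g l ∈ R) (W.bigon γ).index := by
  obtain ⟨χ, h⟩ := hR.exists_isCoherent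
  rw [← W.length_signs γ l]
  exact isGapSet_of_isAntiparallel fun g hg => h _ hg

theorem IsLadder.isGapSet_strip (hR : W.IsLadder R) (T : Face) (c : Fin 3) :
    IsGapSet (fun t => Cell.strip T c t ∈ R) ((W.face T).arcs c).length := by
  obtain ⟨χ, h⟩ := hR.exists_isCoherent
  exact isGapSet_of_isAntiparallel fun g hg => h _ hg

theorem IsLadder.gapStep (hR : W.IsLadder R) {γ : Edge} {l : ℕ}
    (hl : l < (W.bigon γ).bars.length) : GapStep (fun g => Cell.bigon γ g l ∈ R)
      (fun g => Cell.bigon γ g (l + 1) ∈ R) ((W.bigon γ).bar l) where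
  iff_of_ne g hg := by
    by_cases hg' : g ≤ (W.bigon γ).index
    · exact hR.isRegion.seamEnds_mem_iff (s := .level γ g l) ⟨hg', hl, hg.symm⟩
    · exact iff_of_false (fun h => hg' ((hR.isGapSet_bigon γ l).lt g h).le)
        (fun h => hg' ((hR.isGapSet_bigon γ (l + 1)).lt g h).le)
  not_left := hR.lateral_notMem (.bar γ l false) hl
  not_right := hR.lateral_notMem (.bar γ l true) hl
  not_both h := by
    -- A crossbar reverses both of its lines, so the gap above it and the gap below it cannot be
    -- coherent with the same `χ`.
    obtain ⟨χ, hχ⟩ := hR.exists_isCoherent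
    have h₁ := (hχ _ h.1).2.2
    have h₂ := (hχ _ h.2).2.1
    rw [W.getElem?_signs_succ hl, Nat.add_sub_cancel, if_pos rfl, h₁] at h₂
    cases χ <;> simp at h₂

/-! ### Elimination of ladders. -/

/-- The web in a triangle obtained by interchanging the arcs on the two sides of a ladder. -/
noncomputable def reduceFace (W : LocalWeb 𝒯) (R : Set (Cell Face Edge)) (T : Face) :
    TriangleWeb where
  degree := (W.face T).degree
  arcs c := twist (fun t => Cell.strip T c t ∈ R) ((W.face T).arcs c)

/-- The gaps on a side of a triangle which belong to a given set of cells. -/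
def sideGaps (W : LocalWeb 𝒯) (R : Set (Cell Face Edge)) (T : Face) (k : Fin 3) (j : ℕ) : Prop :=
  j ≤ ((W.face T).sideWord k).length ∧ W.sideCell T k j ∈ R

theorem IsLadder.isGapSet_sideGaps (hR : W.IsLadder R) (T : Face) (k : Fin 3) :
    IsGapSet (W.sideGaps R T k) ((W.face T).sideWord k).length := by
  obtain ⟨χ, h⟩ := hR.exists_isCoherent
  refine isGapSet_of_isAntiparallel (χ := χ) fun j hj => ?_
  exact (isCoherent_sideCell hj.1 fun a e => hR.comb_notMem T a (e ▸ hj.2)).1 (h _ hj.2)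

/-- The ladder avoids all pyramid cells, so on a side of the triangle it only exchanges arcs around
the same corner, and both ends of an arc are moved consistently. -/
theorem IsLadder.twist_sideWord (hR : W.IsLadder R) (T : Face) (k : Fin 3) :
    twist (W.sideGaps R T k) ((W.face T).sideWord k) = (W.reduceFace R T).sideWord k := by
  have hl := length_sideWord (W.face T) k
  have hS := hR.isGapSet_sideGaps T k
  have hA := hR.isGapSet_strip T (k + 2)
  have hC := hR.isGapSet_strip T k
  set S := W.sideGaps R T k with hSdef
  have hlow : ∀ j < ((W.face T).arcs (k + 2)).length, (S j ↔ Cell.strip T (k + 2) j ∈ R) := by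
    intro j hj
    simp only [hSdef, sideGaps, sideCell, if_pos hj]
    exact and_iff_right (by omega)
  have hmid : ∀ j, ((W.face T).arcs (k + 2)).length ≤ j →
      j ≤ ((W.face T).arcs (k + 2)).length + (W.face T).degree.natAbs → ¬ S j := by
    rintro j h₁ h₂ ⟨-, h⟩
    simp only [sideCell, if_neg h₁.not_gt, if_pos h₂] at h
    exact hR.comb_notMem _ _ h
  have hhigh : ∀ j ≤ ((W.face T).arcs k).length,
      (S (((W.face T).arcs (k + 2)).length + (W.face T).degree.natAbs + j) ↔
        Cell.strip T k (((W.face T).arcs k).length - j) ∈ R) := by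
    intro j hj
    rcases Nat.eq_zero_or_pos j with rfl | h₀
    -- This is the gap next to the pyramid part; it belongs to a cell of type `comb`, while strip
    -- indices stop below the number of arcs.
    · refine iff_of_false (hmid _ (by omega) (by omega)) fun h => ?_
      exact lt_irrefl _ (hC.lt _ h)
    · simp only [hSdef, sideGaps, sideCell]
      rw [if_neg (by omega), if_neg (by omega), and_iff_right (by omega), hl,
        Nat.add_sub_add_left]
  have hS' : IsGapSet (fun j =>
      S (((W.face T).arcs (k + 2)).length + (W.face T).degree.natAbs + j))
      ((W.face T).arcs k).length := by
    refine ⟨hmid _ (by omega) (by omega), fun g hg => ?_, fun g hg => hS.isolated _ hg⟩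
    have := hS.lt _ hg
    omega
  have hno : ∀ n, IsGapSet (fun _ => False) n := fun n => ⟨id, fun _ h => h.elim, fun _ h => h.elim⟩
  have hlen : ((W.face T).arcs (k + 2) ++ List.replicate (W.face T).degree.natAbs
      (decide (0 < (W.face T).degree))).length =
      ((W.face T).arcs (k + 2)).length + (W.face T).degree.natAbs := by simp
  have e₁ : twist (fun t => Cell.strip T (k + 2) t ∈ R) ((W.face T).arcs (k + 2) ++
      List.replicate (W.face T).degree.natAbs (decide (0 < (W.face T).degree))) =
      twist (fun t => Cell.strip T (k + 2) t ∈ R) ((W.face T).arcs (k + 2)) ++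
        List.replicate (W.face T).degree.natAbs (decide (0 < (W.face T).degree)) := by
    rw [twist_append (R := fun _ => False) (hA.mono (by simp)) hA (hno _) (fun _ _ => Iff.rfl)
      (fun h => lt_irrefl _ (hA.lt _ h)), twist_of_forall_not fun _ => id]
    refine fun j hj => iff_of_false (fun h => ?_) id
    have := hA.lt _ h
    omega
  have e₂ : twist (fun j => S (((W.face T).arcs (k + 2)).length + (W.face T).degree.natAbs + j))
      (((W.face T).arcs k).map (fun b => !b)).reverse =
      ((twist (fun t => Cell.strip T k t ∈ R) ((W.face T).arcs k)).map (fun b => !b)).reverse := by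
    rw [twist_reverse (by simpa using hS') (by simpa using hC), twist_map _ hC]
    simpa using hhigh
  refine (twist_append hS (hA.mono (by simp)) (by simpa using hS') ?_ ?_ ?_).trans
    (congrArg₂ (· ++ ·) e₁ e₂)
  · intro j hj
    rw [hlen] at hj
    by_cases h : j < ((W.face T).arcs (k + 2)).length
    · exact hlow j h
    · exact iff_of_false (hmid j (by omega) (by omega)) fun h' => h (hA.lt _ h')
  · rw [hlen]
    exact hmid _ (by omega) (by omega)
  · intro j hj
    rw [hlen]

theorem sideGaps_iff (hR : W.IsRegion R) {T : Face} {k : Fin 3} {j : ℕ}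
    (hj : j ≤ ((W.face T).sideWord k).length) : W.sideGaps R T k j ↔
      W.bigonSideCell (𝒯.side (T, k)).1 (𝒯.side (T, k)).2
        (if (𝒯.side (T, k)).2 then j else ((W.face T).sideWord k).length - j) ∈ R :=
  (and_iff_right hj).trans (hR.seamEnds_mem_iff (s := .wall T k j) hj)

/-- Eliminate a ladder: interchange the lines on its two sides and delete the crossbars at its
ends. -/
noncomputable def reduce (hR : W.IsLadder R) : LocalWeb 𝒯 where
  face := W.reduceFace R
  bigon γ := ⟨twist (fun g => Cell.bigon γ g 0 ∈ R) (W.bigon γ).plusSig,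
    prune (fun l g => Cell.bigon γ g l ∈ R) (W.bigon γ).bars⟩
  minimal γ := isMinimal_prune (W.minimal γ) (P := fun l g => Cell.bigon γ g l ∈ R)
    (fun l _ => hR.isGapSet_bigon γ l) (fun l hl => hR.gapStep hl)
  match_plus T k γ h := by
    rw [← hR.twist_sideWord, W.match_plus T k γ h]
    refine congrArg (fun P => twist P ((W.face T).sideWord k)) (funext fun j => ?_)
    by_cases hj : j ≤ ((W.face T).sideWord k).length
    · have := sideGaps_iff hR.isRegion hj
      rw [h] at this
      exact propext this.symm
    · refine propext (iff_of_false (fun h' => hj ?_) fun h' => hj h'.1)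
      rw [← W.index_eq h]
      exact ((hR.isGapSet_bigon γ 0).lt j h').le
  match_minus T k γ h := by
    have hg := hR.isGapSet_bigon γ (W.bigon γ).bars.length
    rw [W.index_eq h] at hg
    rw [CrossbarWeb.minusSig, foldl_prune (P := fun l g => Cell.bigon γ g l ∈ R)
      (fun l _ => hR.isGapSet_bigon γ l) (fun l hl => hR.gapStep hl)
      (ProperFrom.add_one_lt (W.minimal γ).1), ← CrossbarWeb.minusSig, W.match_minus T k γ h,
      twist_reverse (by simpa using hg) (by simpa using hR.isGapSet_sideGaps T k),
      twist_map _ (hR.isGapSet_sideGaps T k), hR.twist_sideWord]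
    intro j hj
    rw [List.length_map] at hj ⊢
    have := sideGaps_iff hR.isRegion (Nat.sub_le ((W.face T).sideWord k).length j)
    rw [h] at this
    rw [this]
    simp [bigonSideCell, Nat.sub_sub_self hj]

theorem count_arcs_reduce (hR : W.IsLadder R) (T : Face) (c : Fin 3) (b : Bool) :
    (((reduce hR).face T).arcs c).count b = ((W.face T).arcs c).count b :=
  (twist_perm (hR.isGapSet_strip T c)).count_eq b

theorem length_bars_reduce_le (hR : W.IsLadder R) (γ : Edge) :
    ((reduce hR).bigon γ).bars.length ≤ (W.bigon γ).bars.length :=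
  length_prune_le _ _

theorem exists_length_bars_reduce_lt (hR : W.IsLadder R) :
    ∃ γ, ((reduce hR).bigon γ).bars.length < (W.bigon γ).bars.length := by
  obtain ⟨γ, l, hl, h⟩ := hR.exists_bar
  exact ⟨γ, length_prune_lt hl h⟩

/-- The bound `4 ≤ n + 2 * m` rules out the pairs `(m, n)` equal to `(0, 0)`, `(0, 2)`, `(1, 0)` and
`(1, 1)`; only `(0, 4)` is left. -/
theorem exists_isLadder_of_not_weaklyReduced [Finite Face] [Finite Edge] {W : LocalWeb 𝒯}
    (h : ¬ W.WeaklyReduced) : ∃ R, W.IsLadder R := by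
  by_contra! h'
  refine h ⟨fun R => ⟨fun hR => ?_, fun hR => ?_, fun hR => h' R hR.isLadder⟩,
    fun R => ⟨fun hR => ?_, fun hR => ?_⟩⟩
  all_goals
    have := hR.four_le.1
    omega

/-! ### Counts, matching conditions and the realization of their solutions. -/

/-- The numbers of the pyramid vertices on a side and of the arcs of both kinds around each corner,
for all triangles. -/
def faceCounts (t : Face → TriangleWeb) : Face × Option (Fin 3 × Bool) → ℕ
  | (T, none) => (t T).degree.natAbs
  | (T, some (c, b)) => ((t T).arcs c).count b

/-- The numbers `faceCounts` of a web. -/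
abbrev counts (W : LocalWeb 𝒯) : Face × Option (Fin 3 × Bool) → ℕ := faceCounts W.face

/-- The number of endpoints of sign `b` on side `x.2` of the triangle `x.1`, in terms of the numbers
`faceCounts`. -/
noncomputable def sideCount (ε : Face → ℤˣ) (x : Face × Fin 3) (b : Bool) :
    (Face × Option (Fin 3 × Bool) → ℕ) →+ ℕ :=
  Pi.evalAddMonoidHom (fun _ => ℕ) (x.1, some (x.2 + 2, b)) +
    (if b = decide (ε x.1 = 1) then Pi.evalAddMonoidHom (fun _ => ℕ) (x.1, none) else 0) +
    Pi.evalAddMonoidHom (fun _ => ℕ) (x.1, some (x.2, !b))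

theorem count_map_not (b : Bool) (l : List Bool) :
    (l.map (fun b => !b)).count b = l.count (!b) := by
  induction l with
  | nil => rfl
  | cons a l ih => cases a <;> cases b <;> simp_all

/-- This is where the profile matters: it decides to which sign the endpoints of the pyramid
contribute, and in degree 0 there are none, so either sign gives the same count. -/
theorem count_sideWord {t : Face → TriangleWeb} {ε : Face → ℤˣ}
    (ht : ∀ T, 0 ≤ (ε T : ℤ) * (t T).degree) (T : Face) (k : Fin 3) (b : Bool) :
    ((t T).sideWord k).count b = sideCount ε (T, k) b (faceCounts t) := by
  have hd : (List.replicate (t T).degree.natAbs (decide (0 < (t T).degree))).count b =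
      if b = decide (ε T = 1) then (t T).degree.natAbs else 0 := by
    have h := ht T
    rw [List.count_replicate]
    rcases Int.units_eq_one_or (ε T) with e | e
    · rcases eq_or_ne (t T).degree 0 with h₀ | h₀
      · simp [h₀]
      · have : 0 < (t T).degree := by
          rw [e] at h
          simp at h
          omega
        cases b <;> simp [this, e]
    · rcases eq_or_ne (t T).degree 0 with h₀ | h₀
      · simp [h₀]
      · have : ¬ 0 < (t T).degree := by
          rw [e] at h
          simp at h
          omega
        have h1 : (-1 : ℤˣ) ≠ 1 := by decide
        cases b <;> simp [this, e, h1]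
  rw [TriangleWeb.sideWord, List.count_append, List.count_append, List.count_reverse,
    count_map_not, hd]
  simp only [sideCount, AddMonoidHom.add_apply, Pi.evalAddMonoidHom_apply]
  split_ifs <;> rfl

/-- The number of strands of sign `b` at the edge to which side `x.2` of `x.1` is attached. -/
noncomputable def edgeCount (𝒯 : IdealTriangulation Face Edge) (ε : Face → ℤˣ) (x : Face × Fin 3)
    (b : Bool) : (Face × Option (Fin 3 × Bool) → ℕ) →+ ℕ :=
  sideCount ε x (if (𝒯.side x).2 then b else !b)

theorem count_plusSig {W : LocalWeb 𝒯} {ε : Face → ℤˣ} (hW : W.HasProfile ε) (x : Face × Fin 3)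
    (b : Bool) : (W.bigon (𝒯.side x).1).plusSig.count b = edgeCount 𝒯 ε x b W.counts := by
  obtain ⟨T, k⟩ := x
  rcases h : 𝒯.side (T, k) with ⟨γ, _ | _⟩
  · have hp : (W.bigon γ).minusSig.Perm (W.bigon γ).plusSig := foldl_swapAt_perm _ _
    simp only [edgeCount, h]
    rw [← hp.count_eq, W.match_minus T k γ h, List.count_reverse, count_map_not,
      count_sideWord hW]
    simp
  · simp only [edgeCount, h]
    rw [W.match_plus T k γ h, count_sideWord hW]
    simp

/-- A side of a triangle attached to a given edge. -/
noncomputable def someSide (𝒯 : IdealTriangulation Face Edge) (γ : Edge) : Face × Fin 3 :=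
  (𝒯.edge_has_side γ).choose

theorem side_someSide (𝒯 : IdealTriangulation Face Edge) (γ : Edge) :
    (𝒯.side (someSide 𝒯 γ)).1 = γ :=
  (𝒯.edge_has_side γ).choose_spec

/-- The submonoid of the numbers `faceCounts` which match along all edges. -/
noncomputable def matching (𝒯 : IdealTriangulation Face Edge) (ε : Face → ℤˣ) :
    AddSubmonoid (Face × Option (Fin 3 × Bool) → ℕ) :=
  AddMonoidHom.eqLocusM
    (AddMonoidHom.pi fun y : (Face × Fin 3) × Bool => edgeCount 𝒯 ε y.1 y.2)
    (AddMonoidHom.pi fun y : (Face × Fin 3) × Bool =>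
      edgeCount 𝒯 ε (someSide 𝒯 (𝒯.side y.1).1) y.2)

theorem mem_matching {ε : Face → ℤˣ} {a : Face × Option (Fin 3 × Bool) → ℕ} :
    a ∈ matching 𝒯 ε ↔
      ∀ x b, edgeCount 𝒯 ε x b a = edgeCount 𝒯 ε (someSide 𝒯 (𝒯.side x).1) b a := by
  rw [matching, AddMonoidHom.mem_eqLocusM, funext_iff]
  exact Prod.forall

/-- The equalizer of two additive maps between powers of the natural numbers, with finitely
generated source, is finitely generated, as in Gordan's lemma. -/
theorem fg_matching [Finite Face] (𝒯 : IdealTriangulation Face Edge) (ε : Face → ℤˣ) :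
    (matching 𝒯 ε).FG :=
  AddSubmonoid.fg_eqLocusM _ _

/-- The rotation number in terms of `counts`. -/
def rotationHom (T : Face) : (Face × Option (Fin 3 × Bool) → ℕ) →+ ℤ :=
  ∑ c : Fin 3,
    ((Nat.castAddMonoidHom ℤ).comp (Pi.evalAddMonoidHom (fun _ => ℕ) (T, some (c, true))) -
      (Nat.castAddMonoidHom ℤ).comp (Pi.evalAddMonoidHom (fun _ => ℕ) (T, some (c, false))))

theorem rotationHom_counts (W : LocalWeb 𝒯) (T : Face) :
    rotationHom T W.counts = (W.face T).rotation := by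
  simp [rotationHom, TriangleWeb.rotation, counts, faceCounts]

/-- The coordinates of a web in terms of `counts`. -/
noncomputable def coordinatesHom (𝒯 : IdealTriangulation Face Edge) (ε : Face → ℤˣ) :
    (Face × Option (Fin 3 × Bool) → ℕ) →+ (Edge → ℕ) × (Edge → ℕ) × (Face → ℤ) :=
  (AddMonoidHom.pi fun γ => edgeCount 𝒯 ε (someSide 𝒯 γ) true).prod
    ((AddMonoidHom.pi fun γ => edgeCount 𝒯 ε (someSide 𝒯 γ) false).prod
      (AddMonoidHom.pi rotationHom))

theorem counts_mem_matching {W : LocalWeb 𝒯} {ε : Face → ℤˣ} (hW : W.HasProfile ε) :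
    W.counts ∈ matching 𝒯 ε := by
  refine mem_matching.2 fun x b => ?_
  rw [← count_plusSig hW, ← count_plusSig hW, side_someSide]

theorem coordinates_eq {W : LocalWeb 𝒯} {ε : Face → ℤˣ} (hW : W.HasProfile ε) :
    W.coordinates = coordinatesHom 𝒯 ε W.counts := by
  refine Prod.ext (funext fun γ => ?_) (Prod.ext (funext fun γ => ?_) (funext fun T => ?_))
  · change _ = edgeCount 𝒯 ε (someSide 𝒯 γ) true W.counts
    rw [← count_plusSig hW, side_someSide]
    rfl
  · change _ = edgeCount 𝒯 ε (someSide 𝒯 γ) false W.counts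
    rw [← count_plusSig hW, side_someSide]
    rfl
  · exact (rotationHom_counts W T).symm

/-- The web in a triangle with given numbers of pyramid vertices on a side and of corner arcs. -/
def triangleWebOfCounts (ε : Face → ℤˣ) (a : Face × Option (Fin 3 × Bool) → ℕ) (T : Face) :
    TriangleWeb where
  degree := ε T * a (T, none)
  arcs c := List.replicate (a (T, some (c, true))) true ++
    List.replicate (a (T, some (c, false))) false

/-- Neither the order of the arcs at a corner nor the choice of the minimal crossbar webs affects
the counts, so any choice will do. At an internal edge the matching equations say that the two sign
words are permutations of each other. -/
theorem exists_counts_eq {ε : Face → ℤˣ} {a : Face × Option (Fin 3 × Bool) → ℕ}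
    (ha : a ∈ matching 𝒯 ε) : ∃ W : LocalWeb 𝒯, W.HasProfile ε ∧ W.counts = a := by
  set t := triangleWebOfCounts ε a with ht
  have hε : ∀ T, 0 ≤ (ε T : ℤ) * (t T).degree := fun T => by
    rw [ht, triangleWebOfCounts, ← mul_assoc, ← Units.val_mul, Int.units_mul_self]
    simp
  have hc : faceCounts t = a := by
    funext x
    rcases x with ⟨T, _ | ⟨c, b⟩⟩
    · simp [ht, faceCounts, triangleWebOfCounts, Int.natAbs_mul]
    · cases b <;> simp [ht, faceCounts, triangleWebOfCounts, List.count_replicate]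
  have hB : ∀ γ, ∃ B : CrossbarWeb, B.IsMinimal ∧
      (∀ T k, 𝒯.side (T, k) = (γ, true) → B.plusSig = (t T).sideWord k) ∧
      ∀ T k, 𝒯.side (T, k) = (γ, false) →
        B.minusSig = (((t T).sideWord k).map (fun b => !b)).reverse := by
    intro γ
    by_cases hp : ∃ x, 𝒯.side x = (γ, true) <;> by_cases hm : ∃ x, 𝒯.side x = (γ, false)
    · obtain ⟨x, h⟩ := hp
      obtain ⟨x', h'⟩ := hm
      obtain ⟨B, hB, e, e'⟩ := exists_isMinimal (σ := (t x.1).sideWord x.2)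
        (ρ := (((t x'.1).sideWord x'.2).map (fun b => !b)).reverse) <| by
          refine List.perm_iff_count.2 fun b => ?_
          have h₁ := mem_matching.1 ha x b
          -- Both sides of the edge are compared with the same chosen side, hence with each other.
          rw [h, ← congrArg Prod.fst h', ← mem_matching.1 ha x' b] at h₁
          rw [List.count_reverse, count_map_not, count_sideWord hε, count_sideWord hε, hc]
          simpa [edgeCount, h, h'] using h₁
      refine ⟨B, hB, fun T k hT => ?_, fun T k hT => ?_⟩
      · obtain rfl := 𝒯.side_injective (h.trans hT.symm)
        exact e
      · obtain rfl := 𝒯.side_injective (h'.trans hT.symm)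
        exact e'
    · obtain ⟨x, h⟩ := hp
      -- At a boundary edge only one word is prescribed, and a bigon without crossbars continues it.
      refine ⟨⟨(t x.1).sideWord x.2, []⟩, ⟨trivial, List.nodup_nil⟩, fun T k hT => ?_,
        fun T k hT => (hm ⟨_, hT⟩).elim⟩
      obtain rfl := 𝒯.side_injective (h.trans hT.symm)
      rfl
    · obtain ⟨x, h⟩ := hm
      refine ⟨⟨(((t x.1).sideWord x.2).map (fun b => !b)).reverse, []⟩, ⟨trivial, List.nodup_nil⟩,
        fun T k hT => (hp ⟨_, hT⟩).elim, fun T k hT => ?_⟩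
      obtain rfl := 𝒯.side_injective (h.trans hT.symm)
      rfl
    · exact ⟨⟨[], []⟩, ⟨trivial, List.nodup_nil⟩, fun T k hT => (hp ⟨_, hT⟩).elim,
        fun T k hT => (hm ⟨_, hT⟩).elim⟩
  choose B h₁ h₂ h₃ using hB
  exact ⟨⟨t, B, h₁, fun T k γ h => h₂ γ T k h, fun T k γ h => h₃ γ T k h⟩, hε, hc⟩

/-- Induction on the total number of crossbars: eliminating a ladder lowers it, leaves all degrees
alone and only permutes the arcs around each corner. -/
theorem exists_weaklyReduced [Finite Face] [Finite Edge] {ε : Face → ℤˣ} {W₀ : LocalWeb 𝒯}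
    (h₀ : W₀.HasProfile ε) :
    ∃ W : LocalWeb 𝒯, W.WeaklyReduced ∧ W.HasProfile ε ∧ W.counts = W₀.counts := by
  have := Fintype.ofFinite Edge
  induction hn : ∑ γ, (W₀.bigon γ).bars.length using Nat.strong_induction_on generalizing W₀ with
  | _ n ih =>
    by_cases h : W₀.WeaklyReduced
    · exact ⟨W₀, h, h₀, rfl⟩
    obtain ⟨R, hR⟩ := exists_isLadder_of_not_weaklyReduced h
    have hlt : ∑ γ, ((reduce hR).bigon γ).bars.length < n := by
      obtain ⟨γ, hγ⟩ := exists_length_bars_reduce_lt hR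
      exact hn ▸ Finset.sum_lt_sum (fun γ _ => length_bars_reduce_le hR γ) ⟨γ, Finset.mem_univ γ, hγ⟩
    obtain ⟨W, h₁, h₂, h₃⟩ := ih _ hlt (W₀ := reduce hR) h₀ rfl
    refine ⟨W, h₁, h₂, h₃.trans (funext ?_)⟩
    rintro ⟨T, _ | ⟨c, b⟩⟩
    · rfl
    · exact count_arcs_reduce hR T c b

end LocalWeb

end CanonicalWebs

theorem mainTheorem10 {Face Edge : Type*} [Finite Face] [Finite Edge]
    (𝒯 : CanonicalWebs.IdealTriangulation Face Edge) (ε : Face → ℤˣ) :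
    ∃ S : AddSubmonoid ((Edge → ℕ) × (Edge → ℕ) × (Face → ℤ)),
      (S : Set ((Edge → ℕ) × (Edge → ℕ) × (Face → ℤ))) = CanonicalWebs.coordinateSet 𝒯 ε ∧
        S.FG := by
  refine ⟨(CanonicalWebs.LocalWeb.matching 𝒯 ε).map
    (CanonicalWebs.LocalWeb.coordinatesHom 𝒯 ε), ?_,
    (CanonicalWebs.LocalWeb.fg_matching 𝒯 ε).map _⟩
  ext x
  constructor
  · rintro ⟨a, ha, rfl⟩
    obtain ⟨W₀, h₀, rfl⟩ := CanonicalWebs.LocalWeb.exists_counts_eq ha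
    obtain ⟨W, h₁, h₂, h₃⟩ := CanonicalWebs.LocalWeb.exists_weaklyReduced h₀
    exact ⟨⟨W, h₁⟩, h₂, by rw [CanonicalWebs.LocalWeb.coordinates_eq h₂, h₃]⟩
  · rintro ⟨W, hW, rfl⟩
    exact ⟨_, CanonicalWebs.LocalWeb.counts_mem_matching hW,
      (CanonicalWebs.LocalWeb.coordinates_eq hW).symm⟩
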